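/- Let $X$ be a finite set and let $(X,S)$ be an asymmetric association scheme of rank $3$ and order $n=|X|=4u+3$, $u\ge 0$. That is, $X\times X$ is partitioned into three nonempty relations $R_0,R_1,R_2$, where $R_0$ is the diagonal, the transpose of each $R_i$ is again one of the relations, for all $i,j,k$ the number of $z$ with $(y,z)\in R_i$ and $(z,w)\in R_j$ is the same for all $(y,w)\in R_k$, and not every $R_i$ is symmetric (so $R_2$ is the transpose of $R_1$). Let $A_0=I_n$, $A_1$, $A_2=A_1^{\top}$ be the adjacency matrices. Fix $x\in X$, and for $i=0,1,2$ let $E_i^*$ be the diagonal matrix with $(E_i^*)_{yy}=(A_i)_{xy}$. Let $T_x$ be the complex Terwilliger algebra with respect to $x$, i.e. the subalgebra of the algebra of complex $n\times n$ matrices generated by the $A_i$ and the $E_i^*$. Let $B_1$ be the block of $A_1$ with rows and columns indexed by $\{y : (x,y)\in R_1\}$ (the block corresponding to $E_1^*A_1E_1^*$). Put $\alpha=\frac{-1+\sqrt{-n}}{2}$. The primary module is the $T_x$-submodule of $\mathbb{C}^n$ generated by the all-ones vector; an irreducible $T_x$-module is called non-primary if it is not isomorphic to it. Then the following hold. (i)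 Every non-primary irreducible $T_x$-module has complex dimension $1$ or $2$. (ii) The number of isomorphism classes of $1$-dimensional irreducible $T_x$-modules is either $0$ or $4$, and it is $4$ exactly when $\alpha$ is an eigenvalue of $B_1$. (iii) Let $d_\alpha\ge 0$ be the dimension of the $\alpha$-eigenspace of $B_1$ (so $d_\alpha=0$ if $\alpha$ is not an eigenvalue). The number $m_2$ of isomorphism classes of $2$-dimensional irreducible $T_x$-modules is finite and satisfies $0\le m_2\le 2(u-d_\alpha)$, and $$\dim_{\mathbb{C}} T_x = 9+4\epsilon+4m_2,$$ where $\epsilon=1$ if $T_x$ has a $1$-dimensional irreducible module and $\epsilon=0$ otherwise. -/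

import Mathlib

universe w v

open scoped Matrix.Module

/-- An association scheme with `d` nonidentity classes (that is, of rank `d + 1`) on a finite
set `X`.  The classes `R_0, …, R_d` partition `X × X`; `rel x y` is the index of the class that
contains `(x, y)`. -/
structure AssociationScheme (X : Type w) [Fintype X] (d : ℕ) where
  /-- the index of the class containing the pair `(x, y)` -/
  rel : X → X → Fin (d + 1)
  /-- every class is nonempty -/
  exists_rel : ∀ i, ∃ x y, rel x y = i
  /-- the class of index `0` is the diagonal -/
  rel_eq_zero_iff : ∀ x y, rel x y = 0 ↔ x = y
  /-- the transpose of a class is a class -/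
  exists_transpose : ∀ i, ∃ i', ∀ x y, rel x y = i ↔ rel y x = i'
  /-- existence of the intersection numbers -/
  exists_intersection : ∀ i j k, ∃ p : ℕ, ∀ x y, rel x y = k →
    (Finset.univ.filter fun z => rel x z = i ∧ rel z y = j).card = p

namespace AssociationScheme

variable {X : Type w} [Fintype X] {d : ℕ}

/-- An association scheme is asymmetric if it is not symmetric, i.e. if some class differs
from its transpose. -/
def IsAsymmetric (S : AssociationScheme X d) : Prop :=
  ∃ x y, S.rel x y ≠ S.rel y x

/-- The adjacency matrix `A_i` of the class of index `i`. -/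
def adj (S : AssociationScheme X d) (i : Fin (d + 1)) : Matrix X X ℂ :=
  Matrix.of fun y z => if S.rel y z = i then 1 else 0

/-- The dual idempotent `E_i^*` with respect to `x`: the diagonal matrix whose `(y, y)` entry
is `(A_i)_{xy}`. -/
def dualIdempotent [DecidableEq X] (S : AssociationScheme X d) (x : X) (i : Fin (d + 1)) :
    Matrix X X ℂ :=
  Matrix.diagonal fun y => S.adj i x y

/-- The complex Terwilliger algebra `T_x`: the subalgebra of the full matrix algebra generated
by the adjacency matrices and the dual idempotents with respect to `x`. -/
def terwilliger [DecidableEq X] (S : AssociationScheme X d) (x : X) :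
    Subalgebra ℂ (Matrix X X ℂ) :=
  Algebra.adjoin ℂ (Set.range S.adj ∪ Set.range (S.dualIdempotent x))

/-- The primary module `T_x e`: the submodule of the standard module `ℂ^X` (on which matrices
act by matrix-vector multiplication) generated by the all-ones vector. -/
def primaryModule [DecidableEq X] (S : AssociationScheme X d) (x : X) :
    Submodule (S.terwilliger x) (X → ℂ) :=
  Submodule.span (S.terwilliger x) {fun _ => 1}

/-- The subconstituent `B_i` with respect to `x`: the block of `A_i` whose rows and columns are
indexed by the points `y` with `(x, y)` in the class of index `i`, i.e. the block corresponding
to `E_i^* A_i E_i^*`. -/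
def subconstituent (S : AssociationScheme X d) (x : X) (i : Fin (d + 1)) :
    Matrix {y // S.rel x y = i} {y // S.rel x y = i} ℂ :=
  (S.adj i).submatrix Subtype.val Subtype.val

end AssociationScheme

/-- The complex dimension of a module over a `ℂ`-algebra `T`, where `ℂ` acts through `T`. -/
noncomputable def moduleDim (T : Type w) [Ring T] [Algebra ℂ T] (V : Type v) [AddCommGroup V]
    [Module T V] : ℕ :=
  Module.finrank ℂ (RestrictScalars ℂ T V)

/-- Isomorphism, as an equivalence relation on the irreducible `T`-modules of complex
dimension `k`. -/
def irreducibleSetoid (T : Type w) [Ring T] [Algebra ℂ T] (k : ℕ) :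
    Setoid {V : ModuleCat.{w} T // IsSimpleModule T V ∧ moduleDim T V = k} where
  r V W := Nonempty (V.1 ≃ₗ[T] W.1)
  iseqv :=
    { refl := fun V => ⟨LinearEquiv.refl T V.1⟩
      symm := fun ⟨f⟩ => ⟨f.symm⟩
      trans := fun ⟨f⟩ ⟨g⟩ => ⟨f.trans g⟩ }

/-- The isomorphism classes of irreducible `T`-modules of complex dimension `k`.  An irreducible
module is a quotient of `T`, so modules in the universe of `T` represent all of them. -/
def IrreducibleClass (T : Type w) [Ring T] [Algebra ℂ T] (k : ℕ) : Type (w + 1) :=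
  Quotient (irreducibleSetoid T k)

open scoped Classical in
/-- The number `ε`: `1` if `T` has an irreducible module of complex dimension `1`, and `0`
otherwise. -/
noncomputable def oneDimIndicator (T : Type w) [Ring T] [Algebra ℂ T] : ℕ :=
  if ∃ V : ModuleCat.{w} T, IsSimpleModule T V ∧ moduleDim T V = 1 then 1 else 0

/-! Write `J` for the all-ones matrix, `A_{-j}` for the transpose of `A_j` (indices in `Fin 3`) and
`p(θ) = θ² + θ + (u + 1)`, whose roots are `α` and its conjugate. Counting in the scheme gives `A_j²
= (u + 1)J - (u + 1)I - A_j` for `j ≠ 0` (`adj_mul_self`), and everything follows from this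
quadratic relation.

Let `v ≠ 0` be supported on the `j`-th subconstituent, with coordinate sum zero and `E_j^* A_j v = θ
v`. Then `A_j v = θ v - w`, where the partner `w` is supported on the opposite subconstituent, and
`A_j w = p(θ) v - (θ + 1) w`. Hence `span {v, w}` is a `T`-module on which the action depends on `j`
and `θ` only (`exists_action`). It is irreducible, and `w = 0` exactly when `p(θ) = 0`
(`partner_eq_zero_iff`), so its dimension is 1 or 2. As `w` is again a block eigenvector for `θ`, on
the other side, two-dimensional modules are classified by `θ` alone, one-dimensional ones by the
pair `(j, θ)`.

Together with the primary module these are all the irreducibles. The algebra is closed under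
conjugate transposition, so the standard module is semisimple; being faithful, it contains every
irreducible. An irreducible submodule other than the primary one vanishes at `x`, hence by `J`
consists of vectors of sum zero, and so contains a block eigenvector.

The roots of `p` are conjugate and the matrices are real; moreover the two off-diagonal blocks of
`A_j` are square and related by transposition. So if a root occurs on one side, both occur on both
sides: 0 or 4 one-dimensional classes. The bound on `m₂` comes from independence of eigenspaces
inside the `2u`-dimensional space of sum-zero functions on the first subconstituent. By the density
theorem the dimension of `T` is the sum of the squares of the irreducible dimensions. -/

/-! ### Complex dimension of modules -/

section ModuleDim

variable {T : Type*} [Ring T] [Algebra ℂ T]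

theorem moduleDim_eq_finrank (V : Type*) [AddCommGroup V] [Module T V] [Module ℂ V]
    [IsScalarTower ℂ T V] : moduleDim T V = Module.finrank ℂ V :=
  LinearEquiv.finrank_eq
    { RestrictScalars.addEquiv ℂ T V with
      map_smul' := fun c z => algebraMap_smul T c (RestrictScalars.addEquiv ℂ T V z) }

theorem moduleDim_congr {V W : Type*} [AddCommGroup V] [Module T V] [AddCommGroup W] [Module T W]
    (e : V ≃ₗ[T] W) : moduleDim T V = moduleDim T W :=
  LinearEquiv.finrank_eq
    { (RestrictScalars.addEquiv ℂ T V).trans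
        (e.toAddEquiv.trans (RestrictScalars.addEquiv ℂ T W).symm) with
      map_smul' := fun c z => e.map_smul (algebraMap ℂ T c) (RestrictScalars.addEquiv ℂ T V z) }

end ModuleDim

/-! ### Simple modules over a general ring -/

section Simple

variable {T : Type*} [Ring T]

/-- Two simple modules containing nonzero vectors with the same annihilator are isomorphic. -/
theorem nonempty_linearEquiv_of_smul_eq_zero_iff {V W : Type*} [AddCommGroup V] [Module T V]
    [AddCommGroup W] [Module T W] [IsSimpleModule T V] [IsSimpleModule T W] {v : V} {w : W}
    (hv : v ≠ 0) (hw : w ≠ 0) (h : ∀ t : T, t • v = 0 ↔ t • w = 0) :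
    Nonempty (V ≃ₗ[T] W) := by
  have hk : LinearMap.ker (LinearMap.toSpanSingleton T V v) =
      LinearMap.ker (LinearMap.toSpanSingleton T W w) := by
    ext t
    simp [h]
  exact ⟨((LinearMap.quotKerEquivOfSurjective _
    (IsSimpleModule.toSpanSingleton_surjective T hv)).symm.trans
    (Submodule.quotEquivOfEq _ _ hk)).trans
    (LinearMap.quotKerEquivOfSurjective _ (IsSimpleModule.toSpanSingleton_surjective T hw))⟩

/-- Every simple module over a ring `T` is isomorphic to a submodule of a given faithful
semisimple module whose annihilator is cut out by finitely many vectors. -/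
theorem exists_submodule_linearEquiv_of_faithful {M : Type*} [AddCommGroup M] [Module T M]
    [IsSemisimpleModule T M] {ι : Type*} [Finite ι] (m : ι → M)
    (hm : ∀ t : T, (∀ i, t • m i = 0) → t = 0) (V : Type*) [AddCommGroup V] [Module T V]
    [IsSimpleModule T V] : ∃ N : Submodule T M, Nonempty (V ≃ₗ[T] N) := by
  -- The map `t ↦ (t • m i)_i` embeds `T` in a finite power of `M`, so `T` is semisimple and `V` is
  -- a minimal left ideal. Acting on a suitable `m i` then embeds that ideal in `M`.
  have : IsSemisimpleRing T := by
    refine IsSemisimpleModule.of_injective (LinearMap.toSpanSingleton T (ι → M) m) ?_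
    rw [← LinearMap.ker_eq_bot, LinearMap.ker_eq_bot']
    exact fun t ht => hm t fun i => congrFun ht i
  obtain ⟨I, ⟨e⟩⟩ := IsSemisimpleRing.exists_linearEquiv_ideal_of_isSimpleModule T V
  have : IsSimpleModule T I := IsSimpleModule.congr e.symm
  obtain ⟨⟨t, htI⟩, ht⟩ := @exists_ne I (IsSimpleModule.nontrivial T I) 0
  have : ∃ i, t • m i ≠ 0 := by
    by_contra! h
    exact ht (Subtype.ext (hm t h))
  obtain ⟨i, hi⟩ := this
  set f : I →ₗ[T] M := (LinearMap.toSpanSingleton T M (m i)).comp I.subtype with hf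
  have hf0 : f ≠ 0 := fun h => hi (by simpa [hf] using LinearMap.congr_fun h ⟨t, htI⟩)
  exact ⟨LinearMap.range f, ⟨e.trans (LinearEquiv.ofInjective f (LinearMap.injective_of_ne_zero hf0))⟩⟩

end Simple

/-! ### Density and the sum of squares -/

section Density

variable {K T : Type*} [Field K] [IsAlgClosed K] [Ring T] [Algebra K T]
  {ι : Type*} [Fintype ι] (N : ι → Type*) [∀ i, AddCommGroup (N i)] [∀ i, Module T (N i)]
  [∀ i, Module K (N i)] [∀ i, IsScalarTower K T (N i)] [∀ i, FiniteDimensional K (N i)]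
  [∀ i, IsSimpleModule T (N i)]

/-- A jointly faithful finite family of pairwise nonisomorphic finite-dimensional simple modules
over an algebra `T` over an algebraically closed field determines the dimension of `T`. -/
theorem finrank_eq_sum_sq_of_simple_family
    (hN : ∀ i j, i ≠ j → IsEmpty (N i ≃ₗ[T] N j))
    (hfaith : ∀ t : T, (∀ i, ∀ n : N i, t • n = 0) → t = 0) :
    Module.finrank K T = ∑ i, Module.finrank K (N i) ^ 2 := by
  classical
  let Φ : T →ₗ[K] ∀ i, Module.End K (N i) :=
    LinearMap.pi fun i => (Algebra.lsmul K K (N i)).toLinearMap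
  have hinj : Function.Injective Φ := by
    rw [← LinearMap.ker_eq_bot, LinearMap.ker_eq_bot']
    intro t ht
    refine hfaith t fun i n => ?_
    exact LinearMap.congr_fun (congrFun ht i) n
  -- By Schur's lemma the `T`-endomorphisms of the product act by a scalar on each factor, so they
  -- commute with every tuple of `K`-linear maps.
  have hdiag : ∀ (φ : Module.End T (∀ i, N i)) (i : ι), ∃ c : K, ∀ n, φ n i = c • n i := by
    intro φ i
    have hoff : ∀ j, j ≠ i → (LinearMap.proj i ∘ₗ φ ∘ₗ LinearMap.single T N j) = 0 := by
      intro j hj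
      by_contra h
      exact (hN j i hj).false (LinearEquiv.ofBijective _ (LinearMap.bijective_of_ne_zero h))
    obtain ⟨c, hc⟩ := (IsSimpleModule.algebraMap_end_bijective_of_isAlgClosed (A := T)
      (V := N i) K).2 (LinearMap.proj i ∘ₗ φ ∘ₗ LinearMap.single T N i)
    refine ⟨c, fun n => ?_⟩
    have h1 : φ n = ∑ j, φ (Pi.single j (n j)) := by
      rw [← map_sum, Finset.univ_sum_single]
    rw [h1, Finset.sum_apply, Finset.sum_eq_single i]
    · exact (LinearMap.congr_fun hc (n i)).symm
    · intro j _ hj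
      exact LinearMap.congr_fun (hoff j hj) (n j)
    · simp
  have hsurj : Function.Surjective Φ := by
    intro g
    let F : Module.End (Module.End T (∀ i, N i)) (∀ i, N i) :=
      { toFun := fun n i => g i (n i)
        map_add' := fun a b => by ext i; simp
        map_smul' := fun φ n => by
          ext i
          obtain ⟨c, hc⟩ := hdiag φ i
          simp [hc] }
    -- Density gives agreement on a finite set only; a `K`-spanning set is enough by linearity.
    obtain ⟨s, hs⟩ := Module.Finite.fg_top (R := K) (M := ∀ i, N i)
    obtain ⟨r, hr⟩ := jacobson_density F s
    refine ⟨r, ?_⟩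
    have hr' : ∀ n : ∀ i, N i, F n = r • n := by
      intro n
      have hn : n ∈ Submodule.span K (s : Set (∀ i, N i)) := hs ▸ Submodule.mem_top
      induction hn using Submodule.span_induction with
      | mem m hm => exact hr m hm
      | zero => simp
      | add a b _ _ ha hb => rw [map_add, ha, hb, smul_add]
      | smul c a _ ha =>
        have : F (c • a) = c • F a := by
          ext i
          simp [F]
        rw [this, ha, smul_comm]
    funext i
    ext n
    have := congrFun (hr' (Pi.single i n)) i
    simpa [F, Φ] using this.symm
  rw [(LinearEquiv.ofBijective Φ ⟨hinj, hsurj⟩).finrank_eq, Module.finrank_pi_fintype]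
  exact Finset.sum_congr rfl fun i _ => by rw [Module.finrank_linearMap, sq]

end Density

/-! ### Semisimplicity of the standard module -/

section StandardModule

variable {X : Type*} [Fintype X] [DecidableEq X]

open scoped ComplexOrder in
theorem eq_zero_of_star_dotProduct_self {X : Type*} [Fintype X] {v : X → ℂ}
    (h : star v ⬝ᵥ v = 0) : v = 0 :=
  dotProduct_star_self_eq_zero.mp h

/-- The standard module of a matrix algebra closed under conjugate transposition is semisimple. -/
theorem isSemisimpleModule_of_conjTranspose_mem (A : Subalgebra ℂ (Matrix X X ℂ))
    (hA : ∀ M ∈ A, M.conjTranspose ∈ A) : IsSemisimpleModule A (X → ℂ) := by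
  refine { exists_isCompl := fun N => ?_ }
  -- The orthogonal complement of `N`, stable because `⟨v, Mw⟩ = ⟨M*v, w⟩`.
  let N' : Submodule A (X → ℂ) :=
    { carrier := {w | ∀ v ∈ N, star v ⬝ᵥ w = 0}
      add_mem' := fun ha hb v hv => by rw [dotProduct_add, ha v hv, hb v hv, add_zero]
      zero_mem' := fun v _ => dotProduct_zero _
      smul_mem' := fun M w hw v hv => by
        have h := hw _ (N.smul_mem ⟨_, hA M.1 M.2⟩ hv)
        change star (M.1.conjTranspose.mulVec v) ⬝ᵥ w = 0 at h
        change star v ⬝ᵥ M.1.mulVec w = 0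
        rwa [Matrix.star_mulVec, Matrix.conjTranspose_conjTranspose,
          ← Matrix.dotProduct_mulVec] at h }
  refine ⟨N', ?_, ?_⟩
  · rw [Submodule.disjoint_def]
    intro v hv hv'
    exact eq_zero_of_star_dotProduct_self (hv' v hv)
  · rw [codisjoint_iff, Submodule.eq_top_iff']
    intro v
    let K : Submodule ℂ (EuclideanSpace ℂ X) :=
      (N.restrictScalars ℂ).comap (WithLp.linearEquiv 2 ℂ (X → ℂ)).toLinearMap
    obtain ⟨a, ha, b, hb, hab⟩ := K.exists_add_mem_mem_orthogonal (WithLp.toLp 2 v)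
    have hb' : WithLp.ofLp b ∈ N' := by
      intro w hw
      have := (Submodule.mem_orthogonal K b).mp hb (WithLp.toLp 2 w) hw
      rw [EuclideanSpace.inner_eq_star_dotProduct, dotProduct_comm] at this
      exact this
    have hv : v = WithLp.ofLp a + WithLp.ofLp b := congrArg WithLp.ofLp hab
    rw [hv]
    exact Submodule.add_mem_sup ha hb'

end StandardModule

/-! ### Matrix identities of the scheme -/

namespace AssociationScheme

/-- The all-ones matrix. -/
def allOnes (X : Type*) : Matrix X X ℂ := Matrix.of fun _ _ => 1

variable {X : Type*} [Fintype X] {S : AssociationScheme X 2}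

theorem fin_cases_neg (j k : Fin 3) (hj : j ≠ 0) : k = 0 ∨ k = j ∨ k = -j := by
  revert j k; decide

theorem neg_ne_self {j : Fin 3} (hj : j ≠ 0) : -j ≠ j := by
  revert j; decide

theorem fin_three_neg_ne_zero {j : Fin 3} (hj : j ≠ 0) : -j ≠ 0 := by
  revert j; decide

/-- Negation in `Fin 3` fixes 0 and exchanges 1 and 2. A single asymmetric pair shows that
transposition exchanges the two nondiagonal classes. -/
theorem rel_swap (hS : S.IsAsymmetric) (y z : X) : S.rel z y = -S.rel y z := by
  obtain ⟨a, b, hab⟩ := hS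
  have hne : a ≠ b := by
    rintro rfl
    exact hab rfl
  have h0 : S.rel a b ≠ 0 := fun h => hne ((S.rel_eq_zero_iff a b).mp h)
  have h0' : S.rel b a ≠ 0 := fun h => hne ((S.rel_eq_zero_iff b a).mp h).symm
  have hba : S.rel b a = -S.rel a b := by
    rcases fin_cases_neg (S.rel a b) (S.rel b a) h0 with h | h | h
    · exact absurd h h0'
    · exact absurd h.symm hab
    · exact h
  obtain ⟨i', hi'⟩ := S.exists_transpose (S.rel a b)
  have hi : i' = -S.rel a b := ((hi' a b).mp rfl).symm.trans hba
  subst hi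
  rcases fin_cases_neg (S.rel a b) (S.rel y z) h0 with h | h | h
  · have := (S.rel_eq_zero_iff y z).mp h
    subst this
    rw [h]
    rfl
  · rw [h, (hi' y z).mp h]
  · rw [h, neg_neg, (hi' z y).mpr h]

theorem rel_eq_neg_iff (hS : S.IsAsymmetric) (y z : X) (j : Fin 3) :
    S.rel z y = j ↔ S.rel y z = -j := by
  rw [rel_swap hS y z, neg_eq_iff_eq_neg]

theorem adj_apply (S : AssociationScheme X 2) (i : Fin 3) (y z : X) :
    S.adj i y z = if S.rel y z = i then 1 else 0 := rfl

theorem adj_zero [DecidableEq X] (S : AssociationScheme X 2) : S.adj 0 = 1 := by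
  ext y z
  rw [adj_apply, Matrix.one_apply]
  exact if_congr (S.rel_eq_zero_iff y z) rfl rfl

theorem adj_transpose (hS : S.IsAsymmetric) (i : Fin 3) :
    (S.adj i).transpose = S.adj (-i) := by
  ext y z
  exact if_congr (rel_eq_neg_iff hS y z i) rfl rfl

theorem adj_conjTranspose (hS : S.IsAsymmetric) (i : Fin 3) :
    (S.adj i).conjTranspose = S.adj (-i) := by
  rw [← adj_transpose hS]
  ext y z
  simp only [Matrix.conjTranspose_apply, Matrix.transpose_apply, adj_apply]
  split_ifs <;> simp

theorem adj_add_adj_neg [DecidableEq X] (S : AssociationScheme X 2) {j : Fin 3} (hj : j ≠ 0) :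
    S.adj j + S.adj (-j) = allOnes X - 1 := by
  rw [← adj_zero S]
  ext y z
  simp only [Matrix.add_apply, Matrix.sub_apply, adj_apply, allOnes, Matrix.of_apply]
  rcases fin_cases_neg j (S.rel y z) hj with h | h | h <;> rw [h]
  · simp [hj.symm, (fin_three_neg_ne_zero hj).symm]
  · simp [hj, (neg_ne_self hj).symm]
  · simp [hj, neg_ne_self hj]

theorem exists_adj_mul_allOnes (hS : S.IsAsymmetric) (i : Fin 3) :
    ∃ k : ℕ, S.adj i * allOnes X = (k : ℂ) • allOnes X := by
  obtain ⟨k, hk⟩ := S.exists_intersection i (-i) 0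
  refine ⟨k, ?_⟩
  ext y z
  have h := hk y y ((S.rel_eq_zero_iff y y).mpr rfl)
  simp only [rel_eq_neg_iff hS _ _ (-i), neg_neg, and_self] at h
  simp [Matrix.mul_apply, adj_apply, allOnes, ← h]

theorem allOnes_transpose (X : Type*) : (allOnes X).transpose = allOnes X := rfl

theorem allOnes_mul_allOnes (X : Type*) [Fintype X] :
    allOnes X * allOnes X = (Fintype.card X : ℂ) • allOnes X := by
  ext y z
  simp [Matrix.mul_apply, allOnes]

omit [Fintype X] in
theorem smul_allOnes_inj (y : X) {a b : ℂ} (h : a • allOnes X = b • allOnes X) : a = b := by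
  simpa [allOnes] using congrFun (congrFun h y) y

variable [DecidableEq X] {u : ℕ}

theorem adj_mul_allOnes (hS : S.IsAsymmetric) (hu : Fintype.card X = 4 * u + 3) {j : Fin 3}
    (hj : j ≠ 0) : S.adj j * allOnes X = (2 * u + 1 : ℂ) • allOnes X := by
  have hX : Nonempty X := Fintype.card_pos_iff.mp (by omega)
  obtain ⟨y⟩ := hX
  obtain ⟨k, hk⟩ := exists_adj_mul_allOnes hS j
  obtain ⟨l, hl⟩ := exists_adj_mul_allOnes hS (-j)
  have hk' : allOnes X * S.adj (-j) = (k : ℂ) • allOnes X := by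
    have := congrArg Matrix.transpose hk
    rwa [Matrix.transpose_mul, Matrix.transpose_smul, adj_transpose hS, allOnes_transpose] at this
  have hcard : (Fintype.card X : ℂ) = 4 * u + 3 := by
    rw [hu]
    push_cast
    ring
  -- The product `J A_{-j} J` is evaluated in two ways, so the valencies `k` and `l` agree; their
  -- sum is `4u + 2`.
  have h1 : (k : ℂ) * Fintype.card X = l * Fintype.card X := by
    apply smul_allOnes_inj y
    rw [← smul_smul, ← smul_smul, ← allOnes_mul_allOnes, ← Matrix.smul_mul, ← hk', Matrix.mul_assoc,
      hl, Matrix.mul_smul]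
  have hkl : (k : ℂ) = l := by
    refine mul_right_cancel₀ ?_ h1
    rw [Nat.cast_ne_zero]
    omega
  have h2 : (k : ℂ) + l = Fintype.card X - 1 := by
    apply smul_allOnes_inj y
    rw [add_smul, ← hk, ← hl, ← Matrix.add_mul, adj_add_adj_neg S hj, Matrix.sub_mul,
      Matrix.one_mul, allOnes_mul_allOnes, sub_smul, one_smul]
  have h3 : (k : ℂ) = 2 * u + 1 := by
    rw [← hkl, hcard] at h2
    linear_combination h2 / 2
  rw [hk, h3]

theorem allOnes_mul_adj (hS : S.IsAsymmetric) (hu : Fintype.card X = 4 * u + 3) {j : Fin 3}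
    (hj : j ≠ 0) : allOnes X * S.adj j = (2 * u + 1 : ℂ) • allOnes X := by
  have := congrArg Matrix.transpose (adj_mul_allOnes hS hu (fin_three_neg_ne_zero hj))
  rwa [Matrix.transpose_mul, Matrix.transpose_smul, adj_transpose hS, allOnes_transpose,
    neg_neg] at this

theorem adj_mul_adj_neg (hS : S.IsAsymmetric) (hu : Fintype.card X = 4 * u + 3) {j : Fin 3}
    (hj : j ≠ 0) : S.adj j * S.adj (-j) = (u + 1 : ℂ) • 1 + (u : ℂ) • allOnes X := by
  have hX : Nonempty X := Fintype.card_pos_iff.mp (by omega)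
  obtain ⟨x₀⟩ := hX
  have hk := adj_mul_allOnes hS hu hj
  obtain ⟨a, ha⟩ := S.exists_intersection j (-j) j
  have entry : ∀ y z, (S.adj j * S.adj (-j)) y z =
      ((Finset.univ.filter fun w => S.rel y w = j ∧ S.rel w z = -j).card : ℂ) := by
    intro y z
    simp [Matrix.mul_apply, adj_apply, ← ite_and, and_comm]
  have key : S.adj j * S.adj (-j) = (2 * u + 1 - a : ℂ) • 1 + (a : ℂ) • allOnes X := by
    ext y z
    rcases fin_cases_neg j (S.rel y z) hj with h | h | h
    · have hyz := (S.rel_eq_zero_iff y z).mp h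
      subst hyz
      have h1 := congrFun (congrFun hk y) y
      simp only [Matrix.mul_apply, allOnes, Matrix.of_apply, mul_one, Matrix.smul_apply,
        smul_eq_mul] at h1
      simp only [Matrix.mul_apply, Matrix.add_apply, Matrix.smul_apply, Matrix.one_apply_eq,
        allOnes, Matrix.of_apply, smul_eq_mul, mul_one, sub_add_cancel]
      rw [← h1]
      refine Finset.sum_congr rfl fun w _ => ?_
      simp only [adj_apply, rel_eq_neg_iff hS y w, neg_neg]
      split_ifs <;> simp
    · have hyz : y ≠ z := fun e => hj (h.symm.trans ((S.rel_eq_zero_iff y z).mpr e))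
      rw [entry, ha y z h]
      simp [hyz, allOnes]
    · have hyz : y ≠ z := fun e =>
        fin_three_neg_ne_zero hj (h.symm.trans ((S.rel_eq_zero_iff y z).mpr e))
      have h' : S.rel z y = j := (rel_eq_neg_iff hS y z j).mpr h
      -- The counted set is symmetric in `y` and `z`, so the number `a` also serves the class `-j`.
      have hc : (Finset.univ.filter fun w => S.rel y w = j ∧ S.rel w z = -j) =
          Finset.univ.filter fun w => S.rel z w = j ∧ S.rel w y = -j := by
        ext w
        simp only [Finset.mem_filter, Finset.mem_univ, true_and, rel_eq_neg_iff hS y w,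
          rel_eq_neg_iff hS z w, neg_neg]
        exact and_comm
      rw [entry, hc, ha z y h']
      simp [hyz, allOnes]
  -- Multiplying by `J` gives `(2u + 1)² = (2u + 1 - a) + a(4u + 3)`, whence `a = u`.
  have hsq := congrArg (· * allOnes X) key
  simp only [Matrix.mul_assoc, adj_mul_allOnes hS hu (fin_three_neg_ne_zero hj), Matrix.mul_smul, hk,
    Matrix.add_mul, Matrix.smul_mul, Matrix.one_mul, allOnes_mul_allOnes, smul_smul, ← add_smul] at hsq
  have hs := smul_allOnes_inj x₀ hsq
  rw [hu] at hs
  push_cast at hs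
  have hne : (4 * u + 2 : ℂ) ≠ 0 := by exact_mod_cast (by omega : 4 * u + 2 ≠ 0)
  have hau : (a : ℂ) = u := by
    apply mul_right_cancel₀ hne
    linear_combination -hs
  rw [key, hau]
  congr 2
  ring

theorem adj_mul_self (hS : S.IsAsymmetric) (hu : Fintype.card X = 4 * u + 3) {j : Fin 3}
    (hj : j ≠ 0) :
    S.adj j * S.adj j = (u + 1 : ℂ) • allOnes X - (u + 1 : ℂ) • 1 - S.adj j := by
  have h1 : S.adj j = allOnes X - 1 - S.adj (-j) := by
    rw [← adj_add_adj_neg S hj, add_sub_cancel_right]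
  have h2 := adj_mul_adj_neg hS hu (fin_three_neg_ne_zero hj)
  rw [neg_neg] at h2
  have h3 : S.adj j * S.adj j = (allOnes X - 1 - S.adj (-j)) * S.adj j := by rw [← h1]
  rw [h3, Matrix.sub_mul, Matrix.sub_mul, allOnes_mul_adj hS hu hj, Matrix.one_mul, h2]
  module

end AssociationScheme

/-! ### Cyclic and simple submodules of the standard module -/

section Generic

variable {X : Type*} [Fintype X] [DecidableEq X] {A : Subalgebra ℂ (Matrix X X ℂ)}

theorem mulVec_mem_submodule (N : Submodule A (X → ℂ)) {M : Matrix X X ℂ} (hM : M ∈ A) {v : X → ℂ}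
    (hv : v ∈ N) : M.mulVec v ∈ N :=
  N.smul_mem ⟨M, hM⟩ hv

theorem mem_span_singleton_iff_exists_mulVec {v w : X → ℂ} :
    w ∈ Submodule.span A {v} ↔ ∃ M ∈ A, M.mulVec v = w := by
  rw [Submodule.mem_span_singleton]
  exact ⟨fun ⟨t, ht⟩ => ⟨t.1, t.2, ht⟩, fun ⟨M, hM, h⟩ => ⟨⟨M, hM⟩, h⟩⟩

theorem isSimpleModule_span_singleton {v : X → ℂ} (hv : v ≠ 0)
    (h : ∀ w ∈ Submodule.span A {v}, w ≠ 0 → v ∈ Submodule.span A {w}) :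
    IsSimpleModule A (Submodule.span A {v}) := by
  rw [isSimpleModule_iff_isAtom]
  refine ⟨fun hb => hv (Submodule.span_singleton_eq_bot.mp hb), fun N hN => ?_⟩
  by_contra hN0
  obtain ⟨w, hw, hw0⟩ := (Submodule.ne_bot_iff N).mp hN0
  refine hN.not_ge ?_
  rw [Submodule.span_singleton_le_iff_mem]
  exact (Submodule.span_singleton_le_iff_mem w N).mpr hw (h w (hN.le hw) hw0)

theorem eq_of_isSimpleModule_of_mem {N N' : Submodule A (X → ℂ)} [hN : IsSimpleModule A N]
    [hN' : IsSimpleModule A N'] {v : X → ℂ} (hv : v ∈ N) (hv' : v ∈ N') (h0 : v ≠ 0) : N = N' := by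
  rw [isSimpleModule_iff_isAtom] at hN hN'
  by_contra hne
  have := (hN.disjoint_of_ne hN' hne)
  exact h0 (Submodule.disjoint_def.mp this v hv hv')

end Generic

/-! ### The Terwilliger algebra and its generators -/

namespace AssociationScheme

variable {X : Type*} [Fintype X] [DecidableEq X] (S : AssociationScheme X 2) (x : X)

theorem adj_mem_terwilliger (i : Fin 3) : S.adj i ∈ S.terwilliger x :=
  Algebra.subset_adjoin (Or.inl ⟨i, rfl⟩)

theorem dualIdempotent_mem_terwilliger (i : Fin 3) : S.dualIdempotent x i ∈ S.terwilliger x :=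
  Algebra.subset_adjoin (Or.inr ⟨i, rfl⟩)

theorem dualIdempotent_mulVec_apply (i : Fin 3) (v : X → ℂ) (y : X) :
    (S.dualIdempotent x i).mulVec v y = if S.rel x y = i then v y else 0 := by
  simp [dualIdempotent, Matrix.mulVec_diagonal, adj_apply]

variable {S x}

@[elab_as_elim]
theorem terwilliger_induction {P : ∀ M, M ∈ S.terwilliger x → Prop}
    (hA : ∀ i, P (S.adj i) (S.adj_mem_terwilliger x i))
    (hE : ∀ i, P (S.dualIdempotent x i) (S.dualIdempotent_mem_terwilliger x i))
    (hc : ∀ c : ℂ, P (algebraMap ℂ _ c) (Subalgebra.algebraMap_mem _ c))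
    (hadd : ∀ M N hM hN, P M hM → P N hN → P (M + N) (add_mem hM hN))
    (hmul : ∀ M N hM hN, P M hM → P N hN → P (M * N) (mul_mem hM hN))
    {M : Matrix X X ℂ} (hM : M ∈ S.terwilliger x) : P M hM := by
  induction hM using Algebra.adjoin_induction with
  | mem M hM =>
    rcases hM with ⟨i, rfl⟩ | ⟨i, rfl⟩
    · exact hA i
    · exact hE i
  | algebraMap c => exact hc c
  | add M N hM hN h1 h2 => exact hadd M N hM hN h1 h2
  | mul M N hM hN h1 h2 => exact hmul M N hM hN h1 h2

theorem conjTranspose_mem_terwilliger (hS : S.IsAsymmetric) (M : Matrix X X ℂ)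
    (hM : M ∈ S.terwilliger x) : M.conjTranspose ∈ S.terwilliger x := by
  induction hM using terwilliger_induction with
  | hA i => rw [adj_conjTranspose hS]; exact S.adj_mem_terwilliger x _
  | hE i =>
    have : (S.dualIdempotent x i).conjTranspose = S.dualIdempotent x i := by
      rw [dualIdempotent, Matrix.diagonal_conjTranspose]
      congr 1
      funext y
      simp only [Pi.star_apply, adj_apply]
      split_ifs <;> simp
    rw [this]
    exact S.dualIdempotent_mem_terwilliger x i
  | hc c =>
    have : (algebraMap ℂ (Matrix X X ℂ) c).conjTranspose = algebraMap ℂ _ (star c) := by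
      rw [Algebra.algebraMap_eq_smul_one, Algebra.algebraMap_eq_smul_one,
        Matrix.conjTranspose_smul, Matrix.conjTranspose_one]
    rw [this]
    exact Subalgebra.algebraMap_mem _ _
  | hadd M N _ _ h1 h2 => rw [Matrix.conjTranspose_add]; exact add_mem h1 h2
  | hmul M N _ _ h1 h2 => rw [Matrix.conjTranspose_mul]; exact mul_mem h2 h1

theorem isSemisimpleModule_standard (hS : S.IsAsymmetric) :
    IsSemisimpleModule (S.terwilliger x) (X → ℂ) :=
  isSemisimpleModule_of_conjTranspose_mem _ (conjTranspose_mem_terwilliger hS)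

theorem exists_standard_submodule (hS : S.IsAsymmetric) (V : Type*) [AddCommGroup V]
    [Module (S.terwilliger x) V] [IsSimpleModule (S.terwilliger x) V] :
    ∃ N : Submodule (S.terwilliger x) (X → ℂ), Nonempty (V ≃ₗ[S.terwilliger x] N) := by
  have := isSemisimpleModule_standard (x := x) hS
  -- A matrix that kills the standard basis is zero.
  refine exists_submodule_linearEquiv_of_faithful (fun y : X => (Pi.single y 1 : X → ℂ)) ?_ V
  intro t ht
  ext y z
  have := congrFun (ht z) y
  change t.1.mulVec (Pi.single z 1) y = 0 at this
  simpa using this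

omit [DecidableEq X] in
theorem allOnes_mulVec (v : X → ℂ) : (allOnes X).mulVec v = fun _ => ∑ y, v y := by
  funext y
  simp [allOnes, Matrix.mulVec, dotProduct]

theorem allOnes_mem_terwilliger : allOnes X ∈ S.terwilliger x := by
  have h : allOnes X = 1 + (S.adj 1 + S.adj (-1)) := by
    rw [adj_add_adj_neg S (by decide), add_sub_cancel]
  rw [h]
  exact add_mem (one_mem _) (add_mem (S.adj_mem_terwilliger x _) (S.adj_mem_terwilliger x _))

theorem sum_dualIdempotent_mulVec {j : Fin 3} (hj : j ≠ 0) (v : X → ℂ) :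
    (S.dualIdempotent x 0).mulVec v + (S.dualIdempotent x j).mulVec v +
      (S.dualIdempotent x (-j)).mulVec v = v := by
  funext y
  simp only [Pi.add_apply, dualIdempotent_mulVec_apply]
  rcases fin_cases_neg j (S.rel x y) hj with h | h | h <;> rw [h]
  · simp [hj.symm, (fin_three_neg_ne_zero hj).symm]
  · simp [hj, (neg_ne_self hj).symm]
  · simp [fin_three_neg_ne_zero hj, neg_ne_self hj]

theorem dualIdempotent_mulVec_self (i : Fin 3) (v : X → ℂ) :
    (S.dualIdempotent x i).mulVec ((S.dualIdempotent x i).mulVec v) =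
      (S.dualIdempotent x i).mulVec v := by
  funext y
  simp only [dualIdempotent_mulVec_apply]
  split_ifs <;> rfl

theorem dualIdempotent_mulVec_of_ne {i j : Fin 3} (hij : i ≠ j) {v : X → ℂ}
    (hv : (S.dualIdempotent x j).mulVec v = v) : (S.dualIdempotent x i).mulVec v = 0 := by
  rw [← hv]
  funext y
  simp only [dualIdempotent_mulVec_apply, Pi.zero_apply]
  split_ifs with h1 h2
  · exact absurd (h1.symm.trans h2) hij
  · rfl
  · rfl

theorem dualIdempotent_zero_mulVec (v : X → ℂ) :
    (S.dualIdempotent x 0).mulVec v = v x • Pi.single x 1 := by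
  funext y
  rw [dualIdempotent_mulVec_apply]
  simp only [S.rel_eq_zero_iff x y, Pi.smul_apply, smul_eq_mul]
  split_ifs with h
  · subst h; simp
  · simp [Ne.symm h]

/-! ### Block eigenvectors and their partners -/

section Eigenvectors

variable (S x) in
/-- The vectors of coordinate sum zero supported on the `j`-th subconstituent that are
eigenvectors (or zero) of the block of `A_j` there, with eigenvalue `θ`. -/
def blockEigenspace (j : Fin 3) (θ : ℂ) : Submodule ℂ (X → ℂ) where
  carrier := {v | ∑ y, v y = 0 ∧ (S.dualIdempotent x j).mulVec v = v ∧
    (S.dualIdempotent x j).mulVec ((S.adj j).mulVec v) = θ • v}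
  add_mem' := by
    rintro a b ⟨a1, a2, a3⟩ ⟨b1, b2, b3⟩
    refine ⟨?_, ?_, ?_⟩
    · simp only [Pi.add_apply, Finset.sum_add_distrib, a1, b1, add_zero]
    · rw [Matrix.mulVec_add, a2, b2]
    · rw [Matrix.mulVec_add, Matrix.mulVec_add, a3, b3, smul_add]
  zero_mem' := by simp
  smul_mem' := by
    rintro c a ⟨a1, a2, a3⟩
    refine ⟨?_, ?_, ?_⟩
    · simp only [Pi.smul_apply, ← Finset.smul_sum, a1, smul_zero]
    · rw [Matrix.mulVec_smul, a2]
    · rw [Matrix.mulVec_smul, Matrix.mulVec_smul, a3, smul_comm]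

variable (S) in
/-- The component of `-A_j v` on the opposite subconstituent, for `v` in
`blockEigenspace S x j θ`. -/
def partner (j : Fin 3) (θ : ℂ) (v : X → ℂ) : X → ℂ := θ • v - (S.adj j).mulVec v

variable {u : ℕ} {j : Fin 3} {θ : ℂ} {v : X → ℂ}

theorem allOnes_mulVec_of_mem (hv : v ∈ blockEigenspace S x j θ) : (allOnes X).mulVec v = 0 := by
  rw [allOnes_mulVec, hv.1]
  rfl

omit [DecidableEq X] in
theorem adj_mulVec_of_mem : (S.adj j).mulVec v = θ • v - partner S j θ v := by
  rw [partner, sub_sub_cancel]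

theorem dualIdempotent_mulVec_partner_self (hv : v ∈ blockEigenspace S x j θ) :
    (S.dualIdempotent x j).mulVec (partner S j θ v) = 0 := by
  rw [partner, Matrix.mulVec_sub, Matrix.mulVec_smul, hv.2.1, hv.2.2, sub_self]

/-- Row `x` of `A_j` sums the entries over the `j`-th subconstituent. That contains the support of
`v`, so the result is the coordinate sum, which is zero. -/
theorem partner_apply_base (hj : j ≠ 0) (hv : v ∈ blockEigenspace S x j θ) :
    partner S j θ v x = 0 := by
  have hsupp : ∀ y, S.rel x y ≠ j → v y = 0 := by
    intro y hy
    rw [← hv.2.1, dualIdempotent_mulVec_apply, if_neg hy]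
  have hx : v x = 0 := hsupp x (by rw [(S.rel_eq_zero_iff x x).mpr rfl]; exact hj.symm)
  have hA : (S.adj j).mulVec v x = 0 := by
    rw [← hv.1]
    refine Finset.sum_congr rfl fun y _ => ?_
    change S.adj j x y * v y = v y
    rw [adj_apply]
    split_ifs with h
    · rw [one_mul]
    · rw [zero_mul, hsupp y h]
  simp [partner, hx, hA]

theorem dualIdempotent_mulVec_partner (hj : j ≠ 0) (hv : v ∈ blockEigenspace S x j θ) :
    (S.dualIdempotent x (-j)).mulVec (partner S j θ v) = partner S j θ v := by
  have h := sum_dualIdempotent_mulVec (S := S) (x := x) hj (partner S j θ v)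
  rwa [dualIdempotent_mulVec_partner_self hv, dualIdempotent_zero_mulVec, partner_apply_base hj hv,
    zero_smul, zero_add, zero_add] at h

theorem allOnes_mulVec_partner (hS : S.IsAsymmetric) (hu : Fintype.card X = 4 * u + 3)
    (hj : j ≠ 0) (hv : v ∈ blockEigenspace S x j θ) :
    (allOnes X).mulVec (partner S j θ v) = 0 := by
  rw [partner, Matrix.mulVec_sub, Matrix.mulVec_smul, Matrix.mulVec_mulVec,
    allOnes_mul_adj hS hu hj, Matrix.smul_mulVec, allOnes_mulVec_of_mem hv]
  simp

theorem adj_neg_mulVec (hj : j ≠ 0) (hv : (allOnes X).mulVec v = 0) :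
    (S.adj (-j)).mulVec v = -v - (S.adj j).mulVec v := by
  have h := congrArg (fun M => M.mulVec v) (adj_add_adj_neg S hj)
  simp only [Matrix.add_mulVec, Matrix.sub_mulVec, hv, Matrix.one_mulVec, zero_sub] at h
  rw [← h]
  abel

theorem adj_mulVec_partner (hS : S.IsAsymmetric) (hu : Fintype.card X = 4 * u + 3)
    (hj : j ≠ 0) (hv : v ∈ blockEigenspace S x j θ) :
    (S.adj j).mulVec (partner S j θ v) =
      (θ ^ 2 + θ + (u + 1)) • v - (θ + 1) • partner S j θ v := by
  have h2 : (S.adj j).mulVec ((S.adj j).mulVec v) =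
      -((u + 1 : ℂ) • v) - (S.adj j).mulVec v := by
    rw [Matrix.mulVec_mulVec, adj_mul_self hS hu hj, Matrix.sub_mulVec, Matrix.sub_mulVec,
      Matrix.smul_mulVec, Matrix.smul_mulVec, allOnes_mulVec_of_mem hv, Matrix.one_mulVec,
      smul_zero, zero_sub]
  rw [partner, Matrix.mulVec_sub, Matrix.mulVec_smul, h2]
  module

theorem partner_mem (hS : S.IsAsymmetric) (hu : Fintype.card X = 4 * u + 3)
    (hj : j ≠ 0) (hv : v ∈ blockEigenspace S x j θ) :
    partner S j θ v ∈ blockEigenspace S x (-j) θ := by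
  have hJ := allOnes_mulVec_partner hS hu hj hv
  refine ⟨?_, dualIdempotent_mulVec_partner hj hv, ?_⟩
  · rw [allOnes_mulVec] at hJ
    exact congrFun hJ x
  · rw [adj_neg_mulVec hj hJ, adj_mulVec_partner hS hu hj hv]
    simp only [Matrix.mulVec_sub, Matrix.mulVec_neg, Matrix.mulVec_smul,
      dualIdempotent_mulVec_partner hj hv, dualIdempotent_mulVec_of_ne (neg_ne_self hj) hv.2.1]
    module

/-- With `w` the partner, `A_j w` is a multiple of `w` when `θ` is a root, so `⟨v, A_j w⟩ = 0` by
disjointness of supports. The adjoint of `A_j` is `A_{-j}`, and `A_{-j} v = -(1 + θ) v + w`, so the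
same number is `⟨w, w⟩`. -/
theorem partner_eq_zero (hS : S.IsAsymmetric) (hu : Fintype.card X = 4 * u + 3)
    (hj : j ≠ 0) (hv : v ∈ blockEigenspace S x j θ) (hθ : θ ^ 2 + θ + (u + 1) = 0) :
    partner S j θ v = 0 := by
  set w := partner S j θ v with hw
  apply eq_zero_of_star_dotProduct_self
  have horth : star v ⬝ᵥ w = 0 := by
    refine Finset.sum_eq_zero fun y _ => ?_
    by_cases h : S.rel x y = j
    · have := congrFun (dualIdempotent_mulVec_partner_self hv) y
      rw [dualIdempotent_mulVec_apply, if_pos h] at this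
      rw [hw, this, Pi.zero_apply, mul_zero]
    · have : v y = 0 := by rw [← hv.2.1, dualIdempotent_mulVec_apply, if_neg h]
      simp [this]
  have h1 : star v ⬝ᵥ (S.adj j).mulVec w = 0 := by
    rw [adj_mulVec_partner hS hu hj hv, hθ, zero_smul, zero_sub, ← neg_smul, dotProduct_smul,
      horth, smul_zero]
  have h2 : star v ⬝ᵥ (S.adj j).mulVec w = star ((S.adj (-j)).mulVec v) ⬝ᵥ w := by
    rw [Matrix.star_mulVec, adj_conjTranspose hS, neg_neg, Matrix.dotProduct_mulVec]
  have h3 : (S.adj (-j)).mulVec v = -((1 + θ) • v) + w := by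
    rw [adj_neg_mulVec hj (allOnes_mulVec_of_mem hv), hw, partner]
    module
  rw [h1, h3, star_add, add_dotProduct, star_neg, neg_dotProduct, star_smul, smul_dotProduct,
    horth, smul_zero, neg_zero, zero_add] at h2
  exact h2.symm

/-- An element of the Terwilliger algebra acts on the pairs `v, partner v`, for `v` in a given
block eigenspace, by one and the same `2 × 2` matrix. -/
theorem exists_action (hS : S.IsAsymmetric) (hu : Fintype.card X = 4 * u + 3) (hj : j ≠ 0) (θ : ℂ)
    {M : Matrix X X ℂ} (hM : M ∈ S.terwilliger x) :
    ∃ a b c d : ℂ, ∀ v ∈ blockEigenspace S x j θ,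
      M.mulVec v = a • v + b • partner S j θ v ∧
        M.mulVec (partner S j θ v) = c • v + d • partner S j θ v := by
  induction hM using terwilliger_induction with
  | hA i =>
    rcases fin_cases_neg j i hj with rfl | rfl | rfl
    · refine ⟨1, 0, 0, 1, fun v hv => ?_⟩
      simp [adj_zero]
    · refine ⟨θ, -1, θ ^ 2 + θ + (u + 1), -(θ + 1), fun v hv => ⟨?_, ?_⟩⟩
      · rw [adj_mulVec_of_mem (θ := θ)]
        module
      · rw [adj_mulVec_partner hS hu hj hv]
        module
    · refine ⟨-1 - θ, 1, -(θ ^ 2 + θ + (u + 1)), θ, fun v hv => ⟨?_, ?_⟩⟩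
      · rw [adj_neg_mulVec hj (allOnes_mulVec_of_mem hv), adj_mulVec_of_mem (θ := θ)]
        module
      · rw [adj_neg_mulVec hj (allOnes_mulVec_partner hS hu hj hv), adj_mulVec_partner hS hu hj hv]
        module
  | hE i =>
    rcases fin_cases_neg j i hj with rfl | rfl | rfl
    · refine ⟨0, 0, 0, 0, fun v hv => ⟨?_, ?_⟩⟩
      · rw [dualIdempotent_mulVec_of_ne hj.symm hv.2.1]
        module
      · rw [dualIdempotent_mulVec_of_ne (fin_three_neg_ne_zero hj).symm
          (dualIdempotent_mulVec_partner hj hv)]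
        module
    · refine ⟨1, 0, 0, 0, fun v hv => ⟨?_, ?_⟩⟩
      · rw [hv.2.1]
        module
      · rw [dualIdempotent_mulVec_partner_self hv]
        module
    · refine ⟨0, 0, 0, 1, fun v hv => ⟨?_, ?_⟩⟩
      · rw [dualIdempotent_mulVec_of_ne (neg_ne_self hj) hv.2.1]
        module
      · rw [dualIdempotent_mulVec_partner hj hv]
        module
  | hc r =>
    refine ⟨r, 0, 0, r, fun v hv => ?_⟩
    simp [Algebra.algebraMap_eq_smul_one, Matrix.smul_mulVec]
  | hadd M N _ _ h1 h2 =>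
    obtain ⟨a, b, c, d, h⟩ := h1
    obtain ⟨a', b', c', d', h'⟩ := h2
    refine ⟨a + a', b + b', c + c', d + d', fun v hv => ⟨?_, ?_⟩⟩
    · rw [Matrix.add_mulVec, (h v hv).1, (h' v hv).1]
      module
    · rw [Matrix.add_mulVec, (h v hv).2, (h' v hv).2]
      module
  | hmul M N _ _ h1 h2 =>
    obtain ⟨a, b, c, d, h⟩ := h1
    obtain ⟨a', b', c', d', h'⟩ := h2
    -- The rows hold the images of `v` and of its partner, so composition multiplies the matrices in
    -- reverse order: that of `N`, then that of `M`.
    refine ⟨a' * a + b' * c, a' * b + b' * d, c' * a + d' * c, c' * b + d' * d,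
      fun v hv => ⟨?_, ?_⟩⟩
    · rw [← Matrix.mulVec_mulVec, (h' v hv).1, Matrix.mulVec_add, Matrix.mulVec_smul,
        Matrix.mulVec_smul, (h v hv).1, (h v hv).2]
      module
    · rw [← Matrix.mulVec_mulVec, (h' v hv).2, Matrix.mulVec_add, Matrix.mulVec_smul,
        Matrix.mulVec_smul, (h v hv).1, (h v hv).2]
      module

end Eigenvectors

end AssociationScheme

theorem smul_linearEquiv_apply {K R M : Type*} [Field K] [Ring R] [Algebra K R] [AddCommGroup M]
    [Module R M] [Module K M] [IsScalarTower K R M] {N N' : Submodule R M} (e : N ≃ₗ[R] N')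
    {r : R} {c : K} {v : N} (h : r • (v : M) = c • (v : M)) :
    r • (e v : M) = c • (e v : M) := by
  have h1 : r • v = c • v := Subtype.ext h
  have h2 := e.map_smul r v
  rw [h1] at h2
  exact congrArg Subtype.val (h2.symm.trans (e.toLinearMap.map_smul_of_tower c v))

namespace AssociationScheme

variable {X : Type*} [Fintype X] [DecidableEq X] {S : AssociationScheme X 2} {x : X}

theorem moduleDim_submodule (N : Submodule (S.terwilliger x) (X → ℂ)) :
    moduleDim (S.terwilliger x) N = Module.finrank ℂ (N.restrictScalars ℂ) :=
  moduleDim_eq_finrank (T := S.terwilliger x) N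

/-! ### Modules generated by block eigenvectors -/

section EigenvectorModules

variable {u : ℕ} {j j' : Fin 3} {θ θ' : ℂ} {v v' : X → ℂ}

theorem partner_eq_zero_iff (hS : S.IsAsymmetric) (hu : Fintype.card X = 4 * u + 3)
    (hj : j ≠ 0) (hv : v ∈ blockEigenspace S x j θ) (hv0 : v ≠ 0) :
    partner S j θ v = 0 ↔ θ ^ 2 + θ + (u + 1) = 0 := by
  refine ⟨fun h => ?_, partner_eq_zero hS hu hj hv⟩
  have := adj_mulVec_partner hS hu hj hv
  rw [h, Matrix.mulVec_zero, smul_zero, sub_zero] at this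
  exact (smul_eq_zero.mp this.symm).resolve_right hv0

theorem partner_mem_span (j : Fin 3) (θ : ℂ) (v : X → ℂ) :
    partner S j θ v ∈ Submodule.span (S.terwilliger x) {v} := by
  have h0 := Submodule.mem_span_singleton_self (R := S.terwilliger x) v
  exact sub_mem (Submodule.smul_of_tower_mem _ _ h0)
    (mulVec_mem_submodule _ (S.adj_mem_terwilliger x j) h0)

theorem exists_eq_add_of_mem_span (hS : S.IsAsymmetric) (hu : Fintype.card X = 4 * u + 3)
    (hj : j ≠ 0) (hv : v ∈ blockEigenspace S x j θ) {z : X → ℂ}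
    (hz : z ∈ Submodule.span (S.terwilliger x) {v}) :
    ∃ a b : ℂ, z = a • v + b • partner S j θ v := by
  obtain ⟨M, hM, rfl⟩ := mem_span_singleton_iff_exists_mulVec.mp hz
  obtain ⟨a, b, _, _, h⟩ := exists_action hS hu hj θ hM
  exact ⟨a, b, (h v hv).1⟩

theorem dualIdempotent_mulVec_add (hv : v ∈ blockEigenspace S x j θ) (a b : ℂ) :
    (S.dualIdempotent x j).mulVec (a • v + b • partner S j θ v) = a • v := by
  rw [Matrix.mulVec_add, Matrix.mulVec_smul, Matrix.mulVec_smul, hv.2.1,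
    dualIdempotent_mulVec_partner_self hv, smul_zero, add_zero]

theorem dualIdempotent_neg_mulVec_add (hj : j ≠ 0) (hv : v ∈ blockEigenspace S x j θ) (a b : ℂ) :
    (S.dualIdempotent x (-j)).mulVec (a • v + b • partner S j θ v) = b • partner S j θ v := by
  rw [Matrix.mulVec_add, Matrix.mulVec_smul, Matrix.mulVec_smul,
    dualIdempotent_mulVec_of_ne (neg_ne_self hj) hv.2.1, dualIdempotent_mulVec_partner hj hv,
    smul_zero, zero_add]

/-- The dual idempotents split any element of the module into its multiples of `v` and of the
partner `w`. If only `w` survives, it is nonzero, so `p(θ) ≠ 0` and `E_j^* A_j w = p(θ) v` recovers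
`v`. -/
theorem isSimpleModule_span_blockEigenvector (hS : S.IsAsymmetric)
    (hu : Fintype.card X = 4 * u + 3) (hj : j ≠ 0) (hv : v ∈ blockEigenspace S x j θ)
    (hv0 : v ≠ 0) :
    IsSimpleModule (S.terwilliger x) (Submodule.span (S.terwilliger x) {v}) := by
  refine isSimpleModule_span_singleton hv0 fun z hz hz0 => ?_
  obtain ⟨a, b, rfl⟩ := exists_eq_add_of_mem_span hS hu hj hv hz
  set N := Submodule.span (S.terwilliger x) {a • v + b • partner S j θ v} with hN
  have h0 : a • v + b • partner S j θ v ∈ N := Submodule.mem_span_singleton_self _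
  have h1 := mulVec_mem_submodule _ (S.dualIdempotent_mem_terwilliger x j) h0
  have h2 := mulVec_mem_submodule _ (S.dualIdempotent_mem_terwilliger x (-j)) h0
  rw [dualIdempotent_mulVec_add hv] at h1
  rw [dualIdempotent_neg_mulVec_add hj hv] at h2
  have cancel : ∀ {c : ℂ} {y : X → ℂ}, c ≠ 0 → c • y ∈ N → y ∈ N := by
    intro c y hc hy
    have := Submodule.smul_of_tower_mem N c⁻¹ hy
    rwa [inv_smul_smul₀ hc] at this
  by_cases ha : a = 0
  · rw [ha, zero_smul, zero_add] at hz0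
    have hb : b ≠ 0 := fun h => hz0 (by rw [h, zero_smul])
    have hw : partner S j θ v ≠ 0 := fun h => hz0 (by rw [h, smul_zero])
    have hp := fun h => hw (partner_eq_zero hS hu hj hv h)
    have h3 := mulVec_mem_submodule _ (S.dualIdempotent_mem_terwilliger x j)
      (mulVec_mem_submodule _ (S.adj_mem_terwilliger x j) (cancel hb h2))
    rw [adj_mulVec_partner hS hu hj hv, Matrix.mulVec_sub, Matrix.mulVec_smul, Matrix.mulVec_smul,
      hv.2.1, dualIdempotent_mulVec_partner_self hv, smul_zero, sub_zero] at h3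
    exact cancel hp h3
  · exact cancel ha h1

theorem restrictScalars_span_blockEigenvector (hS : S.IsAsymmetric)
    (hu : Fintype.card X = 4 * u + 3) (hj : j ≠ 0) (hv : v ∈ blockEigenspace S x j θ) :
    (Submodule.span (S.terwilliger x) {v}).restrictScalars ℂ =
      Submodule.span ℂ {v, partner S j θ v} := by
  apply le_antisymm
  · intro z hz
    obtain ⟨a, b, rfl⟩ := exists_eq_add_of_mem_span hS hu hj hv hz
    exact Submodule.mem_span_pair.mpr ⟨a, b, rfl⟩
  · rw [Submodule.span_le]
    rintro z (rfl | rfl)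
    · exact Submodule.mem_span_singleton_self _
    · exact partner_mem_span j θ v

theorem moduleDim_span_of_root (hS : S.IsAsymmetric)
    (hu : Fintype.card X = 4 * u + 3) (hj : j ≠ 0) (hv : v ∈ blockEigenspace S x j θ)
    (hv0 : v ≠ 0) (hθ : θ ^ 2 + θ + (u + 1) = 0) :
    moduleDim (S.terwilliger x) (Submodule.span (S.terwilliger x) {v}) = 1 := by
  rw [moduleDim_submodule, restrictScalars_span_blockEigenvector hS hu hj hv,
    partner_eq_zero hS hu hj hv hθ, Set.pair_comm, Submodule.span_insert_zero]
  exact finrank_span_singleton hv0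

theorem moduleDim_span_of_not_root (hS : S.IsAsymmetric)
    (hu : Fintype.card X = 4 * u + 3) (hj : j ≠ 0) (hv : v ∈ blockEigenspace S x j θ)
    (hv0 : v ≠ 0) (hθ : θ ^ 2 + θ + (u + 1) ≠ 0) :
    moduleDim (S.terwilliger x) (Submodule.span (S.terwilliger x) {v}) = 2 := by
  have hli : LinearIndependent ℂ ![v, partner S j θ v] := by
    rw [LinearIndependent.pair_iff]
    intro a b hab
    have h1 := dualIdempotent_mulVec_add hv a b
    have h2 := dualIdempotent_neg_mulVec_add hj hv a b
    rw [hab, Matrix.mulVec_zero] at h1 h2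
    exact ⟨(smul_eq_zero.mp h1.symm).resolve_right hv0,
      (smul_eq_zero.mp h2.symm).resolve_right
        (fun h => hθ ((partner_eq_zero_iff hS hu hj hv hv0).mp h))⟩
  have := finrank_span_eq_card hli
  rw [moduleDim_submodule, restrictScalars_span_blockEigenvector hS hu hj hv]
  rwa [Matrix.range_cons, Matrix.range_cons, Matrix.range_empty, Set.union_empty,
    Set.singleton_union, Fintype.card_fin] at this

/-- By `exists_action`, `M` kills `v` exactly when `a = 0` and either `b = 0` or `p(θ) = 0`. This
does not involve `v`, so the two generators have the same annihilator. -/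
theorem nonempty_linearEquiv_span (hS : S.IsAsymmetric)
    (hu : Fintype.card X = 4 * u + 3) (hj : j ≠ 0) (hv : v ∈ blockEigenspace S x j θ)
    (hv0 : v ≠ 0) (hv' : v' ∈ blockEigenspace S x j θ) (hv0' : v' ≠ 0) :
    Nonempty (Submodule.span (S.terwilliger x) {v} ≃ₗ[S.terwilliger x]
      Submodule.span (S.terwilliger x) {v'}) := by
  have := isSimpleModule_span_blockEigenvector hS hu hj hv hv0
  have := isSimpleModule_span_blockEigenvector hS hu hj hv' hv0'
  have key : ∀ {z z'}, z ∈ blockEigenspace S x j θ → z ≠ 0 → z' ∈ blockEigenspace S x j θ →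
      z' ≠ 0 → ∀ M ∈ S.terwilliger x, M.mulVec z = 0 → M.mulVec z' = 0 := by
    intro z z' hz hz0 hz' hz0' M hM h
    obtain ⟨a, b, _, _, hab⟩ := exists_action hS hu hj θ hM
    rw [(hab z hz).1] at h
    have h1 := dualIdempotent_mulVec_add hz a b
    have h2 := dualIdempotent_neg_mulVec_add hj hz a b
    rw [h, Matrix.mulVec_zero] at h1 h2
    have ha := (smul_eq_zero.mp h1.symm).resolve_right hz0
    rw [(hab z' hz').1, ha, zero_smul, zero_add]
    rcases smul_eq_zero.mp h2.symm with hb | hb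
    · rw [hb, zero_smul]
    · rw [partner_eq_zero_iff hS hu hj hz hz0] at hb
      rw [partner_eq_zero hS hu hj hz' hb, smul_zero]
  refine nonempty_linearEquiv_of_smul_eq_zero_iff
    (v := (⟨v, Submodule.mem_span_singleton_self v⟩ : Submodule.span (S.terwilliger x) {v}))
    (w := (⟨v', Submodule.mem_span_singleton_self v'⟩ : Submodule.span (S.terwilliger x) {v'}))
    (fun h => hv0 (congrArg Subtype.val h)) (fun h => hv0' (congrArg Subtype.val h)) fun t => ?_
  simp only [Subtype.ext_iff]
  exact ⟨key hv hv0 hv' hv0' t.1 t.2, key hv' hv0' hv hv0 t.1 t.2⟩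

/-- The image `z` of `v` is fixed by `E_j^*` and has `E_j^* A_j z = θ z`. In the target, a vector
fixed by `E_j^*` is a multiple of `v'` or of its partner, both of block eigenvalue `θ'`; the second
case needs a nonzero partner. -/
theorem eq_of_linearEquiv_span (hS : S.IsAsymmetric)
    (hu : Fintype.card X = 4 * u + 3) (hj : j ≠ 0) (hj' : j' ≠ 0)
    (hv : v ∈ blockEigenspace S x j θ)
    (hv0 : v ≠ 0) (hv' : v' ∈ blockEigenspace S x j' θ')
    (e : Submodule.span (S.terwilliger x) {v} ≃ₗ[S.terwilliger x]
      Submodule.span (S.terwilliger x) {v'}) :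
    θ = θ' ∧ (j = j' ∨ θ ^ 2 + θ + (u + 1) ≠ 0) := by
  let v₁ : Submodule.span (S.terwilliger x) {v} := ⟨v, Submodule.mem_span_singleton_self v⟩
  have transfer : ∀ M ∈ S.terwilliger x, ∀ c : ℂ, M.mulVec v = c • v →
      M.mulVec (e v₁).1 = c • (e v₁).1 := fun M hM c h =>
    smul_linearEquiv_apply e (r := ⟨M, hM⟩) h
  have hz0 : (e v₁).1 ≠ 0 := by
    intro h
    have : e v₁ = 0 := Subtype.ext h
    rw [LinearEquiv.map_eq_zero_iff] at this
    exact hv0 (congrArg Subtype.val this)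
  obtain ⟨a, b, hab⟩ := exists_eq_add_of_mem_span hS hu hj' hv' (e v₁).2
  have h1 := transfer _ (S.dualIdempotent_mem_terwilliger x j) 1 (by rw [hv.2.1, one_smul])
  have h2 := transfer _ (mul_mem (S.dualIdempotent_mem_terwilliger x j)
    (S.adj_mem_terwilliger x j)) θ (by rw [← Matrix.mulVec_mulVec, hv.2.2])
  rw [one_smul] at h1
  rw [← Matrix.mulVec_mulVec] at h2
  generalize (e v₁).1 = z at *
  have hzmem : z ∈ blockEigenspace S x j θ' ∧ (j = j' ∨ θ' ^ 2 + θ' + (u + 1) ≠ 0) := by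
    rcases fin_cases_neg j' j hj' with rfl | rfl | rfl
    · exact absurd rfl hj
    · rw [hab, dualIdempotent_mulVec_add hv'] at h1
      rw [hab, ← h1]
      exact ⟨Submodule.smul_mem _ _ hv', Or.inl rfl⟩
    · rw [hab, dualIdempotent_neg_mulVec_add hj' hv'] at h1
      rw [← hab] at h1
      refine ⟨?_, Or.inr fun hθ => ?_⟩
      · rw [← h1]
        exact Submodule.smul_mem _ _ (partner_mem hS hu hj' hv')
      · rw [partner_eq_zero hS hu hj' hv' hθ, smul_zero] at h1
        exact hz0 h1.symm
  have hθ : θ = θ' := by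
    have := hzmem.1.2.2
    rw [h2] at this
    exact smul_left_injective ℂ hz0 this
  exact ⟨hθ, hθ ▸ hzmem.2⟩

end EigenvectorModules

/-! ### The primary module and the remaining simple submodules -/

section Primary

variable {u : ℕ}

variable (S x) in
/-- The characteristic vector of the `j`-th subconstituent. -/
def subconstituentVector (j : Fin 3) : X → ℂ := fun y => if S.rel x y = j then 1 else 0

theorem dualIdempotent_mulVec_one (j : Fin 3) :
    (S.dualIdempotent x j).mulVec (fun _ => 1) = subconstituentVector S x j := by
  funext y
  rw [dualIdempotent_mulVec_apply]
  rfl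

omit [DecidableEq X] in
theorem sum_smul_subconstituentVector_apply (c : Fin 3 → ℂ) (y : X) :
    (∑ k, c k • subconstituentVector S x k) y = c (S.rel x y) := by
  simp [subconstituentVector, Finset.sum_apply]

omit [DecidableEq X] in
theorem adj_mulVec_subconstituentVector (hS : S.IsAsymmetric) (i j : Fin 3) :
    ∃ c : Fin 3 → ℂ, (S.adj i).mulVec (subconstituentVector S x j) =
      ∑ k, c k • subconstituentVector S x k := by
  choose p hp using S.exists_intersection i (-j)
  -- For `y` in class `k` from `x`, the pair `(y, x)` lies in class `-k`; the entry at `y` counts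
  -- two-step paths from `y` to `x`.
  refine ⟨fun k => p (-k), ?_⟩
  funext y
  rw [sum_smul_subconstituentVector_apply, ← hp (-S.rel x y) y x (rel_swap hS x y)]
  simp only [Matrix.mulVec, dotProduct, adj_apply, subconstituentVector, rel_eq_neg_iff hS x _ (-j),
    neg_neg]
  simp [← ite_and, and_comm]

theorem dualIdempotent_mulVec_subconstituentVector (i j : Fin 3) :
    (S.dualIdempotent x i).mulVec (subconstituentVector S x j) =
      if i = j then subconstituentVector S x j else 0 := by
  funext y
  rw [dualIdempotent_mulVec_apply]
  by_cases hij : i = j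
  · subst hij
    simp only [subconstituentVector, if_true]
    split_ifs <;> rfl
  · rw [if_neg hij, Pi.zero_apply]
    by_cases h : S.rel x y = i
    · rw [if_pos h, subconstituentVector, if_neg (h ▸ hij)]
    · rw [if_neg h]

theorem restrictScalars_primaryModule (hS : S.IsAsymmetric) :
    (S.primaryModule x).restrictScalars ℂ =
      Submodule.span ℂ (Set.range (subconstituentVector S x)) := by
  have hsum : (fun _ => 1 : X → ℂ) = ∑ k, subconstituentVector S x k := by
    funext y
    have := sum_smul_subconstituentVector_apply (S := S) (x := x) (fun _ => 1) y
    simpa using this.symm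
  have hmem : ∀ k, subconstituentVector S x k ∈
      Submodule.span ℂ (Set.range (subconstituentVector S x)) :=
    fun k => Submodule.subset_span ⟨k, rfl⟩
  apply le_antisymm
  · intro z hz
    obtain ⟨M, hM, hMz⟩ := mem_span_singleton_iff_exists_mulVec.mp hz
    rw [← hMz]
    clear hMz hz
    have stable : ∀ z ∈ Submodule.span ℂ (Set.range (subconstituentVector S x)),
        M.mulVec z ∈ Submodule.span ℂ (Set.range (subconstituentVector S x)) := by
      have gen : ∀ M : Matrix X X ℂ, (∀ k, M.mulVec (subconstituentVector S x k) ∈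
          Submodule.span ℂ (Set.range (subconstituentVector S x))) →
          ∀ z ∈ Submodule.span ℂ (Set.range (subconstituentVector S x)),
          M.mulVec z ∈ Submodule.span ℂ (Set.range (subconstituentVector S x)) := by
        intro M h z hz
        induction hz using Submodule.span_induction with
        | mem z hz =>
          obtain ⟨k, rfl⟩ := hz
          exact h k
        | zero => rw [Matrix.mulVec_zero]; exact zero_mem _
        | add a b _ _ ha hb => rw [Matrix.mulVec_add]; exact add_mem ha hb
        | smul c a _ ha => rw [Matrix.mulVec_smul]; exact Submodule.smul_mem _ _ ha
      induction hM using terwilliger_induction with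
      | hA i =>
        refine gen _ fun k => ?_
        obtain ⟨c, hc⟩ := adj_mulVec_subconstituentVector (x := x) hS i k
        rw [hc]
        exact Submodule.sum_mem _ fun l _ => Submodule.smul_mem _ _ (hmem l)
      | hE i =>
        refine gen _ fun k => ?_
        rw [dualIdempotent_mulVec_subconstituentVector]
        split_ifs
        · exact hmem k
        · exact zero_mem _
      | hc c =>
        intro z hz
        rw [Algebra.algebraMap_eq_smul_one, Matrix.smul_mulVec, Matrix.one_mulVec]
        exact Submodule.smul_mem _ _ hz
      | hadd M N _ _ h1 h2 =>
        intro z hz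
        rw [Matrix.add_mulVec]
        exact add_mem (h1 z hz) (h2 z hz)
      | hmul M N _ _ h1 h2 =>
        intro z hz
        rw [← Matrix.mulVec_mulVec]
        exact h1 _ (h2 z hz)
    refine stable _ ?_
    rw [hsum]
    exact Submodule.sum_mem _ fun k _ => hmem k
  · rw [Submodule.span_le]
    rintro _ ⟨k, rfl⟩
    rw [← dualIdempotent_mulVec_one]
    exact mulVec_mem_submodule _ (S.dualIdempotent_mem_terwilliger x k)
      (Submodule.mem_span_singleton_self _)

theorem subconstituentVector_ne_zero (hS : S.IsAsymmetric) (hu : Fintype.card X = 4 * u + 3)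
    (j : Fin 3) : subconstituentVector S x j ≠ 0 := by
  intro h
  have h' : ∀ y, S.rel x y ≠ j := by
    intro y hy
    have := congrFun h y
    simp [subconstituentVector, hy] at this
  by_cases hj : j = 0
  · exact h' x (hj ▸ (S.rel_eq_zero_iff x x).mpr rfl)
  · have := congrFun (congrFun (adj_mul_allOnes hS hu hj) x) x
    simp only [Matrix.mul_apply, adj_apply, h', if_false, Finset.sum_const_zero, allOnes,
      Matrix.of_apply, Matrix.smul_apply, smul_eq_mul, mul_one] at this
    have h2 : (2 * u + 1 : ℂ) ≠ 0 := by exact_mod_cast (by omega : 2 * u + 1 ≠ 0)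
    exact h2 this.symm

theorem exists_rel_eq (hS : S.IsAsymmetric) (hu : Fintype.card X = 4 * u + 3) (x : X)
    (j : Fin 3) : ∃ y, S.rel x y = j := by
  by_contra! h
  apply subconstituentVector_ne_zero (x := x) hS hu j
  funext y
  simp [subconstituentVector, h y]

theorem moduleDim_primaryModule (hS : S.IsAsymmetric) (hu : Fintype.card X = 4 * u + 3) :
    moduleDim (S.terwilliger x) (S.primaryModule x) = 3 := by
  have hli : LinearIndependent ℂ (subconstituentVector S x) := by
    rw [Fintype.linearIndependent_iff]
    intro g hg k
    obtain ⟨y, hy⟩ := exists_rel_eq hS hu x k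
    have := congrFun hg y
    rwa [sum_smul_subconstituentVector_apply, hy] at this
  rw [moduleDim_submodule, restrictScalars_primaryModule hS, finrank_span_eq_card hli,
    Fintype.card_fin]

/-- A dual idempotent isolates one nonzero coefficient, and `J` turns the resulting vector into a
nonzero multiple of the generator, because the subconstituent is nonempty. -/
theorem isSimpleModule_primaryModule (hS : S.IsAsymmetric) (hu : Fintype.card X = 4 * u + 3) :
    IsSimpleModule (S.terwilliger x) (S.primaryModule x) := by
  refine isSimpleModule_span_singleton (fun h => one_ne_zero (congrFun h x)) fun z hz hz0 => ?_
  have hz' : z ∈ (S.primaryModule x).restrictScalars ℂ := hz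
  rw [restrictScalars_primaryModule hS, Submodule.mem_span_range_iff_exists_fun] at hz'
  obtain ⟨c, rfl⟩ := hz'
  have hc : ∃ j, c j ≠ 0 := by
    by_contra! h
    exact hz0 (by simp [h])
  obtain ⟨j, hj⟩ := hc
  set N := Submodule.span (S.terwilliger x) {∑ k, c k • subconstituentVector S x k}
  have h1 := mulVec_mem_submodule N (S.dualIdempotent_mem_terwilliger x j)
    (Submodule.mem_span_singleton_self _)
  have h2 : (S.dualIdempotent x j).mulVec (∑ k, c k • subconstituentVector S x k) =
      c j • subconstituentVector S x j := by
    simp [Matrix.mulVec_sum, Matrix.mulVec_smul, dualIdempotent_mulVec_subconstituentVector]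
  rw [h2] at h1
  have h3 := mulVec_mem_submodule N allOnes_mem_terwilliger h1
  rw [allOnes_mulVec] at h3
  have h4 : (∑ y, (c j • subconstituentVector S x j) y) ≠ 0 := by
    simp only [Pi.smul_apply, smul_eq_mul, ← Finset.mul_sum]
    refine mul_ne_zero hj ?_
    simp only [subconstituentVector, Finset.sum_boole, ne_eq, Nat.cast_eq_zero,
      Finset.card_eq_zero]
    obtain ⟨y, hy⟩ := exists_rel_eq hS hu x j
    exact Finset.ne_empty_of_mem (a := y) (by simp [hy])
  have h5 := Submodule.smul_of_tower_mem N (∑ y, (c j • subconstituentVector S x j) y)⁻¹ h3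
  convert h5 using 1
  funext y
  exact (inv_mul_cancel₀ h4).symm

theorem single_mem_primaryModule : (Pi.single x 1 : X → ℂ) ∈ S.primaryModule x := by
  have h := mulVec_mem_submodule (S.primaryModule x) (S.dualIdempotent_mem_terwilliger x 0)
    (Submodule.mem_span_singleton_self _)
  rwa [dualIdempotent_zero_mulVec, one_smul] at h

/-- A simple submodule of the standard module other than the primary module is generated by a
block eigenvector. -/
theorem exists_blockEigenvector_of_ne_primaryModule (hS : S.IsAsymmetric)
    (hu : Fintype.card X = 4 * u + 3) (N : Submodule (S.terwilliger x) (X → ℂ))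
    [hN : IsSimpleModule (S.terwilliger x) N] (hne : N ≠ S.primaryModule x) :
    ∃ j θ v, j ≠ 0 ∧ v ∈ blockEigenspace S x j θ ∧ v ≠ 0 ∧
      N = Submodule.span (S.terwilliger x) {v} := by
  have := isSimpleModule_primaryModule (x := x) hS hu
  -- Otherwise `E_0^*` puts a nonzero multiple of the basis vector at `x` into both simple modules,
  -- which then coincide.
  have hx : ∀ w ∈ N, w x = 0 := by
    intro w hw
    by_contra hwx
    apply hne
    have h := mulVec_mem_submodule N (S.dualIdempotent_mem_terwilliger x 0) hw
    rw [dualIdempotent_zero_mulVec] at h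
    exact eq_of_isSimpleModule_of_mem h
      (Submodule.smul_of_tower_mem _ _ single_mem_primaryModule)
      (smul_ne_zero hwx (by simp))
  have hsum : ∀ w ∈ N, ∑ y, w y = 0 := by
    intro w hw
    have h := hx _ (mulVec_mem_submodule N allOnes_mem_terwilliger hw)
    rwa [allOnes_mulVec] at h
  have hNb : N ≠ ⊥ := (isSimpleModule_iff_isAtom.mp hN).1
  obtain ⟨w, hw, hw0⟩ := (Submodule.ne_bot_iff N).mp hNb
  have hj : ∃ j : Fin 3, j ≠ 0 ∧ (S.dualIdempotent x j).mulVec w ≠ 0 := by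
    by_contra! h
    apply hw0
    rw [← sum_dualIdempotent_mulVec (S := S) (x := x) (j := 1) (by decide) w, h 1 (by decide),
      h (-1) (by decide), dualIdempotent_zero_mulVec, hx w hw]
    simp
  obtain ⟨j, hj, hjw⟩ := hj
  -- This is `E_j^* N`, a nonzero space stable under `E_j^* A_j`; an eigenvector there is the
  -- required generator.
  let L : Submodule ℂ (X → ℂ) := N.restrictScalars ℂ ⊓
    LinearMap.ker ((S.dualIdempotent x j).mulVecLin - LinearMap.id)
  have hL : ∀ z, z ∈ L ↔ z ∈ N ∧ (S.dualIdempotent x j).mulVec z = z := by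
    intro z
    simp [L, sub_eq_zero]
  have hstab : ∀ z ∈ L, (S.dualIdempotent x j * S.adj j).mulVecLin z ∈ L := by
    intro z hz
    rw [hL] at hz ⊢
    rw [Matrix.mulVecLin_apply, ← Matrix.mulVec_mulVec]
    exact ⟨mulVec_mem_submodule N (S.dualIdempotent_mem_terwilliger x j)
      (mulVec_mem_submodule N (S.adj_mem_terwilliger x j) hz.1), dualIdempotent_mulVec_self _ _⟩
  have hLn : Nontrivial L := by
    refine Submodule.nontrivial_iff_ne_bot.mpr ((Submodule.ne_bot_iff L).mpr ⟨_, ?_, hjw⟩)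
    rw [hL]
    exact ⟨mulVec_mem_submodule N (S.dualIdempotent_mem_terwilliger x j) hw,
      dualIdempotent_mulVec_self _ _⟩
  obtain ⟨θ, hθ⟩ := Module.End.exists_eigenvalue
    ((S.dualIdempotent x j * S.adj j).mulVecLin.restrict hstab)
  obtain ⟨⟨v, hvL⟩, hv⟩ := hθ.exists_hasEigenvector
  have hv0 : v ≠ 0 := fun h => hv.2 (Subtype.ext h)
  have hvθ := congrArg Subtype.val hv.apply_eq_smul
  rw [hL] at hvL
  have hvm : v ∈ blockEigenspace S x j θ := by
    refine ⟨hsum v hvL.1, hvL.2, ?_⟩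
    rw [Matrix.mulVec_mulVec]
    exact hvθ
  have := isSimpleModule_span_blockEigenvector hS hu hj hvm hv0
  exact ⟨j, θ, v, hj, hvm, hv0, eq_of_isSimpleModule_of_mem hvL.1
    (Submodule.mem_span_singleton_self v) hv0⟩

end Primary

end AssociationScheme

/-! ### Dimension count for independent subspaces -/

section FinrankIndep

/-- The dimensions of an independent finite family of subspaces of `W` add up to at most
the dimension of `W`. -/
theorem sum_finrank_le_of_iSupIndep {K V ι : Type*} [Field K] [AddCommGroup V] [Module K V]
    [FiniteDimensional K V] [Fintype ι] {p : ι → Submodule K V} (hp : iSupIndep p)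
    {W : Submodule K V} (hW : ∀ i, p i ≤ W) :
    ∑ i, Module.finrank K (p i) ≤ Module.finrank K W := by
  classical
  have h := LinearMap.finrank_range_of_inj hp.dfinsupp_lsum_injective
  rw [← Submodule.iSup_eq_range_dfinsupp_lsum] at h
  have h2 : Module.finrank K (Π₀ i, p i) = ∑ i, Module.finrank K (p i) :=
    Module.finrank_directSum K fun i => ↥(p i)
  rw [← h2, ← h]
  exact Submodule.finrank_mono (iSup_le hW)

end FinrankIndep

namespace AssociationScheme

variable {X : Type*} [Fintype X] [DecidableEq X] {S : AssociationScheme X 2} {x : X}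

/-! ### Functions on a subconstituent, extended by zero -/

section Extension

variable (S x) in
/-- Extension by zero of functions on the `j`-th subconstituent. -/
def extendZero (j : Fin 3) : ({y // S.rel x y = j} → ℂ) →ₗ[ℂ] (X → ℂ) where
  toFun f y := if h : S.rel x y = j then f ⟨y, h⟩ else 0
  map_add' f g := by
    funext y
    simp only [Pi.add_apply]
    split_ifs <;> simp
  map_smul' c f := by
    funext y
    simp only [Pi.smul_apply, RingHom.id_apply]
    split_ifs <;> simp

variable {j : Fin 3}

omit [DecidableEq X] in
theorem extendZero_apply_coe (f : {y // S.rel x y = j} → ℂ) (y : {y // S.rel x y = j}) :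
    extendZero S x j f y = f y := dif_pos y.2

omit [DecidableEq X] in
theorem extendZero_injective : Function.Injective (extendZero S x j) := by
  intro f g h
  funext y
  rw [← extendZero_apply_coe f, ← extendZero_apply_coe g, h]

theorem dualIdempotent_mulVec_extendZero (f : {y // S.rel x y = j} → ℂ) :
    (S.dualIdempotent x j).mulVec (extendZero S x j f) = extendZero S x j f := by
  funext y
  rw [dualIdempotent_mulVec_apply]
  split_ifs with h
  · rfl
  · exact (dif_neg h : extendZero S x j f y = 0).symm

theorem extendZero_restrict (v : X → ℂ) :
    extendZero S x j (fun y => v y) = (S.dualIdempotent x j).mulVec v := by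
  funext y
  rw [dualIdempotent_mulVec_apply]
  rfl

omit [DecidableEq X] in
theorem sum_mul_extendZero (g : X → ℂ) (f : {y // S.rel x y = j} → ℂ) :
    ∑ y, g y * extendZero S x j f y = ∑ y : {y // S.rel x y = j}, g y * f y := by
  classical
  rw [← Fintype.sum_subtype_add_sum_subtype (fun y => S.rel x y = j)]
  have h : ∑ y : {y // ¬ S.rel x y = j}, g y * extendZero S x j f y = 0 := by
    refine Finset.sum_eq_zero fun y _ => ?_
    have : extendZero S x j f y = 0 := dif_neg y.2
    rw [this, mul_zero]
  rw [h, add_zero]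
  exact Finset.sum_congr rfl fun y _ => by rw [extendZero_apply_coe]

omit [DecidableEq X] in
theorem sum_extendZero (f : {y // S.rel x y = j} → ℂ) :
    ∑ y, extendZero S x j f y = ∑ y, f y := by
  simpa using sum_mul_extendZero (fun _ => 1) f

theorem adj_mulVec_extendZero (i k : Fin 3) (f : {y // S.rel x y = j} → ℂ) :
    (S.dualIdempotent x k).mulVec ((S.adj i).mulVec (extendZero S x j f)) =
      extendZero S x k (((S.adj i).submatrix Subtype.val Subtype.val).mulVec f) := by
  rw [← extendZero_restrict]
  congr 1
  funext y
  exact sum_mul_extendZero (S.adj i y) f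

end Extension

/-! ### Eigenvalues of the subconstituents -/

section Spectrum

variable {u : ℕ} {j : Fin 3} {θ : ℂ} {v : X → ℂ}

theorem apply_base_eq_zero (hj : j ≠ 0) (hv : (S.dualIdempotent x j).mulVec v = v) : v x = 0 := by
  rw [← hv, dualIdempotent_mulVec_apply, if_neg]
  rw [(S.rel_eq_zero_iff x x).mpr rfl]
  exact hj.symm

theorem adj_mulVec_apply_base (i : Fin 3) (v : X → ℂ) :
    (S.adj i).mulVec v x = ∑ y, (S.dualIdempotent x i).mulVec v y := by
  refine Finset.sum_congr rfl fun y _ => ?_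
  rw [dualIdempotent_mulVec_apply]
  change S.adj i x y * v y = _
  rw [adj_apply]
  split_ifs <;> simp

/-- The entry of `A_j² v` at `x` is `θ` times the coordinate sum by the eigenvalue equation, and `u`
times it by the quadratic relation. -/
theorem sum_eq_zero_of_block_eigenvector (hS : S.IsAsymmetric) (hu : Fintype.card X = 4 * u + 3)
    (hj : j ≠ 0) (hv : (S.dualIdempotent x j).mulVec v = v)
    (hvθ : (S.dualIdempotent x j).mulVec ((S.adj j).mulVec v) = θ • v) (hθ : θ ≠ u) :
    ∑ y, v y = 0 := by
  have h1 : (S.adj j).mulVec ((S.adj j).mulVec v) x = θ * ∑ y, v y := by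
    rw [adj_mulVec_apply_base, hvθ, Finset.mul_sum]
    rfl
  rw [Matrix.mulVec_mulVec, adj_mul_self hS hu hj, Matrix.sub_mulVec, Matrix.sub_mulVec,
    Matrix.smul_mulVec, Matrix.smul_mulVec, allOnes_mulVec, Matrix.one_mulVec] at h1
  simp only [Pi.sub_apply, Pi.smul_apply, smul_eq_mul, apply_base_eq_zero hj hv, mul_zero,
    sub_zero, adj_mulVec_apply_base, hv] at h1
  have h2 : (θ - u) * ∑ y, v y = 0 := by linear_combination -h1
  exact (mul_eq_zero.mp h2).resolve_left (sub_ne_zero.mpr hθ)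

theorem blockEigenspace_eq_map (hS : S.IsAsymmetric) (hu : Fintype.card X = 4 * u + 3)
    (hj : j ≠ 0) (hθ : θ ≠ u) :
    blockEigenspace S x j θ = (Module.End.eigenspace (Matrix.toLin' (S.subconstituent x j)) θ).map
      (extendZero S x j) := by
  apply le_antisymm
  · rintro v ⟨_, h2, h3⟩
    have hv : extendZero S x j (fun y => v y) = v := by rw [extendZero_restrict, h2]
    refine ⟨fun y => v y, ?_, hv⟩
    rw [SetLike.mem_coe, Module.End.mem_eigenspace_iff]
    apply extendZero_injective
    rw [Matrix.toLin'_apply, map_smul, hv, ← h3]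
    conv_rhs => rw [← hv]
    exact (adj_mulVec_extendZero j j _).symm
  · rintro _ ⟨f, hf, rfl⟩
    rw [SetLike.mem_coe, Module.End.mem_eigenspace_iff, Matrix.toLin'_apply] at hf
    have h2 := dualIdempotent_mulVec_extendZero (S := S) (x := x) f
    have h3 : (S.dualIdempotent x j).mulVec ((S.adj j).mulVec (extendZero S x j f)) =
        θ • extendZero S x j f := by
      rw [adj_mulVec_extendZero, ← map_smul, ← hf]
      rfl
    exact ⟨sum_eq_zero_of_block_eigenvector hS hu hj h2 h3 hθ, h2, h3⟩

theorem finrank_blockEigenspace (hS : S.IsAsymmetric) (hu : Fintype.card X = 4 * u + 3)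
    (hj : j ≠ 0) (hθ : θ ≠ u) :
    Module.finrank ℂ (blockEigenspace S x j θ) =
      Module.finrank ℂ (Module.End.eigenspace (Matrix.toLin' (S.subconstituent x j)) θ) := by
  rw [blockEigenspace_eq_map hS hu hj hθ]
  exact (Submodule.equivMapOfInjective _ extendZero_injective _).finrank_eq.symm

theorem blockEigenspace_le_eigenspace :
    blockEigenspace S x j θ ≤
      Module.End.eigenspace (S.dualIdempotent x j * S.adj j).mulVecLin θ := by
  intro v hv
  rw [Module.End.mem_eigenspace_iff, Matrix.mulVecLin_apply, ← Matrix.mulVec_mulVec]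
  exact hv.2.2

theorem card_subconstituent (hS : S.IsAsymmetric) (hu : Fintype.card X = 4 * u + 3) (x : X)
    (hj : j ≠ 0) : Fintype.card {y // S.rel x y = j} = 2 * u + 1 := by
  have h := congrFun (congrFun (adj_mul_allOnes hS hu hj) x) x
  simp only [Matrix.mul_apply, adj_apply, allOnes, Matrix.of_apply, mul_one, Matrix.smul_apply,
    smul_eq_mul, Finset.sum_boole] at h
  rw [Fintype.card_subtype]
  exact_mod_cast h

theorem conj_mem_blockEigenspace (hv : v ∈ blockEigenspace S x j θ) :
    star v ∈ blockEigenspace S x j (star θ) := by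
  have hA : ∀ z : X → ℂ, (S.adj j).mulVec (star z) = star ((S.adj j).mulVec z) := by
    intro z
    funext y
    simp only [Matrix.mulVec, dotProduct, Pi.star_apply, star_sum, star_mul', adj_apply]
    refine Finset.sum_congr rfl fun w _ => ?_
    split_ifs <;> simp
  have hE : ∀ z : X → ℂ, (S.dualIdempotent x j).mulVec (star z) =
      star ((S.dualIdempotent x j).mulVec z) := by
    intro z
    funext y
    simp only [Pi.star_apply, dualIdempotent_mulVec_apply]
    split_ifs <;> simp
  refine ⟨?_, ?_, ?_⟩
  · simp only [Pi.star_apply, ← star_sum, hv.1, star_zero]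
  · rw [hE, hv.2.1]
  · rw [hA, hE, hv.2.2, star_smul]

theorem finrank_blockEigenspace_star :
    Module.finrank ℂ (blockEigenspace S x j (star θ)) =
      Module.finrank ℂ (blockEigenspace S x j θ) := by
  let e : blockEigenspace S x j (star θ) ≃+ blockEigenspace S x j θ :=
    { toFun := fun v => ⟨star v.1, by simpa using conj_mem_blockEigenspace v.2⟩
      invFun := fun v => ⟨star v.1, conj_mem_blockEigenspace v.2⟩
      left_inv := fun v => Subtype.ext (star_star v.1)
      right_inv := fun v => Subtype.ext (star_star v.1)
      map_add' := fun v w => Subtype.ext (star_add v.1 w.1) }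
  -- Conjugation is only semilinear, so the ranks are compared along the automorphism `star` of the
  -- scalars.
  exact congrArg Cardinal.toNat (rank_eq_of_equiv_equiv (star : ℂ → ℂ) e star_involutive.bijective
    fun r m => Subtype.ext (star_smul r m.1))

theorem blockEigenspace_star_ne_bot (h : blockEigenspace S x j θ ≠ ⊥) :
    blockEigenspace S x j (star θ) ≠ ⊥ := by
  obtain ⟨v, hv, hv0⟩ := (Submodule.ne_bot_iff _).mp h
  exact (Submodule.ne_bot_iff _).mpr ⟨star v, conj_mem_blockEigenspace hv, star_ne_zero.mpr hv0⟩

/-- A vector on the `k`-th subconstituent that `A_{-k}` maps into the `k`-th subconstituent has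
coordinate sum zero. -/
theorem sum_eq_zero_of_adj_neg (hS : S.IsAsymmetric) (hu : Fintype.card X = 4 * u + 3)
    {k : Fin 3} (hk : k ≠ 0) {z : X → ℂ} (hz : (S.dualIdempotent x k).mulVec z = z)
    (hAz : (S.dualIdempotent x k).mulVec ((S.adj (-k)).mulVec z) = (S.adj (-k)).mulVec z) :
    ∑ y, z y = 0 := by
  -- This entry is the full coordinate sum of `A_{-k} z`, by the support hypothesis. Evaluated
  -- through `A_k A_{-k} = (u + 1)I + uJ`, it is `u` times the sum of `z`.
  have h1 : (S.adj k).mulVec ((S.adj (-k)).mulVec z) x = (2 * u + 1) * ∑ y, z y := by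
    have := congrFun (congrArg (fun M => M.mulVec z)
      (allOnes_mul_adj hS hu (fin_three_neg_ne_zero hk))) x
    simp only [← Matrix.mulVec_mulVec, Matrix.smul_mulVec, allOnes_mulVec] at this
    rw [adj_mulVec_apply_base, hAz]
    exact this
  rw [Matrix.mulVec_mulVec, adj_mul_adj_neg hS hu hk, Matrix.add_mulVec, Matrix.smul_mulVec,
    Matrix.smul_mulVec, allOnes_mulVec, Matrix.one_mulVec] at h1
  simp only [Pi.add_apply, Pi.smul_apply, smul_eq_mul, apply_base_eq_zero hk hz, mul_zero,
    zero_add] at h1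
  have h2 : (u + 1 : ℂ) * ∑ y, z y = 0 := by linear_combination -h1
  exact (mul_eq_zero.mp h2).resolve_left (by exact_mod_cast u.succ_ne_zero)

/-- The vectors `z` of this kind form a space where `A_k = -1 - A_{-k}` and `A_{-k} A_k = u + 1`,
hence one stable under `A_k`. An eigenvector of `A_k` in it has zero partner, so its eigenvalue is a
root. -/
theorem exists_root_of_adj_neg (hS : S.IsAsymmetric) (hu : Fintype.card X = 4 * u + 3)
    {k : Fin 3} (hk : k ≠ 0) {z : X → ℂ} (hz0 : z ≠ 0) (hz : (S.dualIdempotent x k).mulVec z = z)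
    (hAz : (S.dualIdempotent x k).mulVec ((S.adj (-k)).mulVec z) = (S.adj (-k)).mulVec z) :
    ∃ θ : ℂ, θ ^ 2 + θ + (u + 1) = 0 ∧ blockEigenspace S x k θ ≠ ⊥ := by
  let L : Submodule ℂ (X → ℂ) :=
    LinearMap.ker ((S.dualIdempotent x k).mulVecLin - LinearMap.id) ⊓
      LinearMap.ker ((S.dualIdempotent x k * S.adj (-k)).mulVecLin - (S.adj (-k)).mulVecLin)
  have hL : ∀ z, z ∈ L ↔ (S.dualIdempotent x k).mulVec z = z ∧
      (S.dualIdempotent x k).mulVec ((S.adj (-k)).mulVec z) = (S.adj (-k)).mulVec z := by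
    intro z
    simp [L, sub_eq_zero]
  have hJ : ∀ z ∈ L, (allOnes X).mulVec z = 0 := by
    intro z hz
    rw [hL] at hz
    rw [allOnes_mulVec, sum_eq_zero_of_adj_neg hS hu hk hz.1 hz.2]
    rfl
  have hadj : ∀ z ∈ L, (S.adj k).mulVec z = -z - (S.adj (-k)).mulVec z := by
    intro z hz
    have := adj_neg_mulVec (S := S) (fin_three_neg_ne_zero hk) (hJ z hz)
    rwa [neg_neg] at this
  have hstab : ∀ z ∈ L, (S.adj k).mulVecLin z ∈ L := by
    intro z hz
    have h := (hL z).mp hz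
    rw [hL, Matrix.mulVecLin_apply]
    constructor
    · rw [hadj z hz, Matrix.mulVec_sub, Matrix.mulVec_neg, h.1, h.2]
    · have h2 := adj_mul_adj_neg hS hu (fin_three_neg_ne_zero hk)
      rw [neg_neg] at h2
      rw [Matrix.mulVec_mulVec z (S.adj (-k)), h2, Matrix.add_mulVec, Matrix.smul_mulVec, Matrix.smul_mulVec,
        hJ z hz, smul_zero, add_zero, Matrix.one_mulVec, Matrix.mulVec_smul, h.1]
  have hLn : Nontrivial L := Submodule.nontrivial_iff_ne_bot.mpr
    ((Submodule.ne_bot_iff L).mpr ⟨z, (hL z).mpr ⟨hz, hAz⟩, hz0⟩)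
  obtain ⟨θ, hθ⟩ := Module.End.exists_eigenvalue ((S.adj k).mulVecLin.restrict hstab)
  obtain ⟨⟨v, hvL⟩, hv⟩ := hθ.exists_hasEigenvector
  have hv0 : v ≠ 0 := fun h => hv.2 (Subtype.ext h)
  have hvθ : (S.adj k).mulVec v = θ • v := congrArg Subtype.val hv.apply_eq_smul
  have hv' := (hL v).mp hvL
  have hvm : v ∈ blockEigenspace S x k θ :=
    ⟨sum_eq_zero_of_adj_neg hS hu hk hv'.1 hv'.2, hv'.1, by
      rw [hvθ, Matrix.mulVec_smul, hv'.1]⟩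
  refine ⟨θ, (partner_eq_zero_iff hS hu hk hvm hv0).mp ?_,
    (Submodule.ne_bot_iff _).mpr ⟨v, hvm, hv0⟩⟩
  rw [partner, hvθ, sub_self]

/-- The two off-diagonal blocks are transposes of each other and square, hence simultaneously
singular. -/
theorem exists_root_neg (hS : S.IsAsymmetric) (hu : Fintype.card X = 4 * u + 3)
    (hj : j ≠ 0) (hθ : θ ^ 2 + θ + (u + 1) = 0) (h : blockEigenspace S x j θ ≠ ⊥) :
    ∃ θ' : ℂ, θ' ^ 2 + θ' + (u + 1) = 0 ∧ blockEigenspace S x (-j) θ' ≠ ⊥ := by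
  obtain ⟨v, hv, hv0⟩ := (Submodule.ne_bot_iff _).mp h
  have hj' := fin_three_neg_ne_zero hj
  let C : Matrix {y // S.rel x y = -j} {y // S.rel x y = j} ℂ :=
    (S.adj (-j)).submatrix Subtype.val Subtype.val
  -- Both subconstituents have `2u + 1` points; an arbitrary bijection makes `C` a square matrix
  -- with a determinant.
  let e : {y // S.rel x y = j} ≃ {y // S.rel x y = -j} := Fintype.equivOfCardEq
    ((card_subconstituent hS hu x hj).trans (card_subconstituent hS hu x hj').symm)
  have hvr : extendZero S x j (fun y => v y) = v := by rw [extendZero_restrict, hv.2.1]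
  have hC : C.mulVec (fun y => v y) = 0 := by
    apply extendZero_injective (S := S) (x := x) (j := -j)
    rw [← adj_mulVec_extendZero, hvr, adj_neg_mulVec hj (allOnes_mulVec_of_mem hv),
      adj_mulVec_of_mem (θ := θ), partner_eq_zero hS hu hj hv hθ, map_zero, sub_zero,
      Matrix.mulVec_sub, Matrix.mulVec_neg, Matrix.mulVec_smul,
      dualIdempotent_mulVec_of_ne (neg_ne_self hj) hv.2.1]
    simp
  have hdet : (C.submatrix e id).det = 0 := by
    rw [← Matrix.exists_mulVec_eq_zero_iff]
    refine ⟨fun y => v y, fun h => hv0 ?_, ?_⟩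
    · rw [← hvr, h, map_zero]
    · funext y
      exact congrFun hC (e y)
  rw [← Matrix.det_transpose, ← Matrix.exists_mulVec_eq_zero_iff] at hdet
  obtain ⟨f, hf0, hf⟩ := hdet
  set g : {y // S.rel x y = -j} → ℂ := fun y => f (e.symm y) with hg
  have hCt : C.transpose.mulVec g = 0 := by
    rw [← hf]
    funext y
    simp only [Matrix.mulVec, dotProduct, hg]
    exact (Fintype.sum_equiv e _ _ fun i => by simp).symm
  have hCt' : C.transpose = (S.adj j).submatrix Subtype.val Subtype.val := by
    rw [Matrix.transpose_submatrix, adj_transpose hS, neg_neg]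
  have hg0 : g ≠ 0 := by
    intro h
    apply hf0
    funext y
    simpa [hg] using congrFun h (e y)
  have hz := dualIdempotent_mulVec_extendZero (S := S) (x := x) g
  refine exists_root_of_adj_neg hS hu hj' (z := extendZero S x (-j) g)
    (fun h => hg0 (extendZero_injective (h.trans (map_zero _).symm))) hz ?_
  rw [neg_neg]
  -- Of the three components of `A_j g`, the one on the `j`-th subconstituent is `Cᵀ g = 0`, and the
  -- one at `x` sums `g` over a set off its support.
  have h1 := sum_dualIdempotent_mulVec (S := S) (x := x) hj
    ((S.adj j).mulVec (extendZero S x (-j) g))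
  rwa [adj_mulVec_extendZero j j, ← hCt', hCt, map_zero, add_zero, dualIdempotent_zero_mulVec,
    adj_mulVec_apply_base, dualIdempotent_mulVec_of_ne (neg_ne_self hj).symm hz, Finset.sum_eq_zero,
    zero_smul, zero_add] at h1
  exact fun _ _ => rfl

end Spectrum

end AssociationScheme

theorem smul_eq_zero_of_linearEquiv {R M M' : Type*} [Ring R] [AddCommGroup M] [Module R M]
    [AddCommGroup M'] [Module R M'] {N : Submodule R M} (e : N ≃ₗ[R] M') {r : R}
    (hr : ∀ n : M', r • n = 0) {z : M} (hz : z ∈ N) : r • z = 0 := by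
  have h : r • (⟨z, hz⟩ : N) = 0 := e.injective (by rw [map_smul, hr, map_zero])
  exact congrArg Subtype.val h

namespace AssociationScheme

variable {X : Type w} [Fintype X] [DecidableEq X] {S : AssociationScheme X 2} {x : X} {u : ℕ}

/-! ### The roots of the quadratic -/

section Roots

omit [DecidableEq X] in
theorem root_iff (hu : Fintype.card X = 4 * u + 3) {α : ℂ}
    (hα : α = (-1 + (Real.sqrt (Fintype.card X) : ℂ) * Complex.I) / 2) (θ : ℂ) :
    θ ^ 2 + θ + (u + 1) = 0 ↔ θ = α ∨ θ = star α := by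
  have hs : ((Real.sqrt (Fintype.card X) : ℝ) : ℂ) ^ 2 = 4 * u + 3 := by
    rw [← Complex.ofReal_pow, Real.sq_sqrt (Nat.cast_nonneg _), hu]
    push_cast
    ring
  have hsα : star α = (-1 - (Real.sqrt (Fintype.card X) : ℂ) * Complex.I) / 2 := by
    rw [hα]
    simp [sub_eq_add_neg]
  -- The sum of `α` and its conjugate is `-1`, their product `(1 + n)/4 = u + 1`.
  have hfac : θ ^ 2 + θ + (u + 1) = (θ - α) * (θ - star α) := by
    rw [hsα, hα]
    linear_combination (-1 / 4 : ℂ) * hs +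
      (Real.sqrt (Fintype.card X) : ℂ) ^ 2 / 4 * Complex.I_sq
  rw [hfac, mul_eq_zero, sub_eq_zero, sub_eq_zero]

omit [DecidableEq X] in
theorem im_pos_of_eq (hu : Fintype.card X = 4 * u + 3) {α : ℂ}
    (hα : α = (-1 + (Real.sqrt (Fintype.card X) : ℂ) * Complex.I) / 2) : 0 < α.im := by
  have : α.im = Real.sqrt (Fintype.card X) / 2 := by
    rw [hα]
    simp
  rw [this]
  have : (0 : ℝ) < Fintype.card X := by
    rw [hu]
    positivity
  positivity

end Roots

/-! ### Classification of the irreducible modules -/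

section BlockModule

open scoped Classical in
variable (S x) in
/-- A chosen nonzero vector of `blockEigenspace S x j θ`, if there is one. -/
noncomputable def blockVector (j : Fin 3) (θ : ℂ) : X → ℂ :=
  if h : ∃ v ∈ blockEigenspace S x j θ, v ≠ 0 then h.choose else 0

theorem blockVector_spec {j : Fin 3} {θ : ℂ} (h : blockEigenspace S x j θ ≠ ⊥) :
    blockVector S x j θ ∈ blockEigenspace S x j θ ∧ blockVector S x j θ ≠ 0 := by
  have h' := (Submodule.ne_bot_iff _).mp h
  rw [blockVector, dif_pos h']
  exact h'.choose_spec

variable (S x) in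
/-- The submodule of the standard module generated by a chosen block eigenvector. -/
noncomputable def blockModule (j : Fin 3) (θ : ℂ) : Submodule (S.terwilliger x) (X → ℂ) :=
  Submodule.span (S.terwilliger x) {blockVector S x j θ}

theorem isSimpleModule_blockModule (hS : S.IsAsymmetric) (hu : Fintype.card X = 4 * u + 3)
    {j : Fin 3} (hj : j ≠ 0) {θ : ℂ} (h : blockEigenspace S x j θ ≠ ⊥) :
    IsSimpleModule (S.terwilliger x) (blockModule S x j θ) :=
  isSimpleModule_span_blockEigenvector hS hu hj (blockVector_spec h).1 (blockVector_spec h).2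

variable (S x u) in
/-- The labels of the one-dimensional irreducible modules. -/
def OneDimLabel : Type :=
  {p : Fin 3 × ℂ // p.1 ≠ 0 ∧ p.2 ^ 2 + p.2 + (u + 1) = 0 ∧ blockEigenspace S x p.1 p.2 ≠ ⊥}

variable (S x u) in
/-- The labels of the two-dimensional irreducible modules. -/
def TwoDimLabel : Type :=
  {θ : ℂ // θ ^ 2 + θ + (u + 1) ≠ 0 ∧ blockEigenspace S x 1 θ ≠ ⊥}

variable (S x u) in
/-- Representatives of the isomorphism classes of irreducible modules, as submodules of the
standard module. -/
noncomputable def irreducible : Option (OneDimLabel S x u ⊕ TwoDimLabel S x u) →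
    Submodule (S.terwilliger x) (X → ℂ)
  | none => S.primaryModule x
  | some (Sum.inl p) => blockModule S x p.1.1 p.1.2
  | some (Sum.inr θ) => blockModule S x 1 θ.1

/-- The dimensions of the modules `irreducible S x u i`. -/
def irreducibleDim : Option (OneDimLabel S x u ⊕ TwoDimLabel S x u) → ℕ
  | none => 3
  | some (Sum.inl _) => 1
  | some (Sum.inr _) => 2

variable (hS : S.IsAsymmetric) (hu : Fintype.card X = 4 * u + 3)

include hS hu

theorem isSimpleModule_irreducible (i : Option (OneDimLabel S x u ⊕ TwoDimLabel S x u)) :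
    IsSimpleModule (S.terwilliger x) (irreducible S x u i) := by
  rcases i with _ | p | θ
  · exact isSimpleModule_primaryModule hS hu
  · exact isSimpleModule_blockModule hS hu p.2.1 p.2.2.2
  · exact isSimpleModule_blockModule hS hu (by decide) θ.2.2

theorem moduleDim_irreducible (i : Option (OneDimLabel S x u ⊕ TwoDimLabel S x u)) :
    moduleDim (S.terwilliger x) (irreducible S x u i) = irreducibleDim i := by
  rcases i with _ | p | θ
  · exact moduleDim_primaryModule hS hu
  · obtain ⟨h1, h2⟩ := blockVector_spec p.2.2.2
    exact moduleDim_span_of_root hS hu p.2.1 h1 h2 p.2.2.1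
  · obtain ⟨h1, h2⟩ := blockVector_spec θ.2.2
    exact moduleDim_span_of_not_root hS hu (by decide) h1 h2 θ.2.1

theorem irreducible_label_eq {i i' : Option (OneDimLabel S x u ⊕ TwoDimLabel S x u)}
    (e : irreducible S x u i ≃ₗ[S.terwilliger x] irreducible S x u i') : i = i' := by
  have hd := moduleDim_congr (T := S.terwilliger x) (V := irreducible S x u i)
    (W := irreducible S x u i') e
  rw [moduleDim_irreducible hS hu, moduleDim_irreducible hS hu] at hd
  rcases i with _ | p | θ <;> rcases i' with _ | p' | θ' <;> simp only [irreducibleDim] at hd <;>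
    try omega
  · rfl
  · have h := blockVector_spec p.2.2.2
    obtain ⟨h1, h2⟩ := eq_of_linearEquiv_span hS hu p.2.1 p'.2.1 h.1 h.2
      (blockVector_spec p'.2.2.2).1 e
    have h3 := h2.resolve_right (not_not.mpr p.2.2.1)
    exact congrArg _ (congrArg _ (Subtype.ext (Prod.ext h3 h1)))
  · have h := blockVector_spec θ.2.2
    obtain ⟨h1, _⟩ := eq_of_linearEquiv_span hS hu (by decide) (by decide) h.1 h.2
      (blockVector_spec θ'.2.2).1 e
    exact congrArg _ (congrArg _ (Subtype.ext h1))

theorem exists_linearEquiv_irreducible (V : Type*) [AddCommGroup V] [Module (S.terwilliger x) V]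
    [IsSimpleModule (S.terwilliger x) V] :
    ∃ i, Nonempty (V ≃ₗ[S.terwilliger x] irreducible S x u i) := by
  obtain ⟨N, ⟨e⟩⟩ := exists_standard_submodule (x := x) hS V
  have hN : IsSimpleModule (S.terwilliger x) N := IsSimpleModule.congr e.symm
  suffices h : ∃ i, Nonempty (N ≃ₗ[S.terwilliger x] irreducible S x u i) by
    obtain ⟨i, ⟨f⟩⟩ := h
    exact ⟨i, ⟨e.trans f⟩⟩
  by_cases hP : N = S.primaryModule x
  · exact ⟨none, ⟨LinearEquiv.ofEq _ _ hP⟩⟩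
  obtain ⟨j, θ, z, hj, hz, hz0, rfl⟩ := exists_blockEigenvector_of_ne_primaryModule hS hu N hP
  by_cases hθ : θ ^ 2 + θ + (u + 1) = 0
  · have hb : blockEigenspace S x j θ ≠ ⊥ := (Submodule.ne_bot_iff _).mpr ⟨z, hz, hz0⟩
    exact ⟨some (Sum.inl ⟨(j, θ), hj, hθ, hb⟩), nonempty_linearEquiv_span hS hu hj hz hz0
      (blockVector_spec hb).1 (blockVector_spec hb).2⟩
  -- A generator on the second subconstituent is replaced by its partner, which is nonzero since `θ`
  -- is not a root and generates the same simple module.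
  · have h1 : ∃ z' ∈ blockEigenspace S x 1 θ, z' ≠ 0 ∧
        Submodule.span (S.terwilliger x) {z} = Submodule.span (S.terwilliger x) {z'} := by
      have : j = 1 ∨ -j = 1 := by clear hz; revert j; decide
      rcases this with rfl | hj1
      · exact ⟨z, hz, hz0, rfl⟩
      · have hp0 : partner S j θ z ≠ 0 :=
          fun h => hθ ((partner_eq_zero_iff hS hu hj hz hz0).mp h)
        have hpm := partner_mem hS hu hj hz
        have := isSimpleModule_span_blockEigenvector hS hu (fin_three_neg_ne_zero hj) hpm hp0
        exact ⟨_, hj1 ▸ hpm, hp0, eq_of_isSimpleModule_of_mem (partner_mem_span j θ z)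
          (Submodule.mem_span_singleton_self _) hp0⟩
    obtain ⟨z', hz', hz0', heq⟩ := h1
    have hb : blockEigenspace S x 1 θ ≠ ⊥ := (Submodule.ne_bot_iff _).mpr ⟨z', hz', hz0'⟩
    obtain ⟨f⟩ := nonempty_linearEquiv_span hS hu (by decide) hz' hz0'
      (blockVector_spec hb).1 (blockVector_spec hb).2
    exact ⟨some (Sum.inr ⟨θ, hθ, hb⟩), ⟨(LinearEquiv.ofEq _ _ heq).trans f⟩⟩

theorem exists_equiv_irreducibleClass (k : ℕ) :
    Nonempty ({i : Option (OneDimLabel S x u ⊕ TwoDimLabel S x u) // irreducibleDim i = k} ≃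
      IrreducibleClass (S.terwilliger x) k) := by
  let F : {i : Option (OneDimLabel S x u ⊕ TwoDimLabel S x u) // irreducibleDim i = k} →
      IrreducibleClass (S.terwilliger x) k := fun i =>
    Quotient.mk _ ⟨ModuleCat.of _ (irreducible S x u i.1), isSimpleModule_irreducible hS hu i.1,
      (moduleDim_irreducible hS hu i.1).trans i.2⟩
  refine ⟨Equiv.ofBijective F ⟨fun i i' h => ?_, fun q => ?_⟩⟩
  · obtain ⟨e⟩ := Quotient.exact h
    exact Subtype.ext (irreducible_label_eq hS hu e)
  · induction q using Quotient.inductionOn with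
    | h V =>
      have := V.2.1
      obtain ⟨i, ⟨e⟩⟩ := exists_linearEquiv_irreducible (x := x) hS hu V.1
      refine ⟨⟨i, ?_⟩, Quotient.sound ⟨e.symm⟩⟩
      exact ((moduleDim_irreducible hS hu i).symm.trans
        (moduleDim_congr (W := irreducible S x u i) e).symm).trans V.2.2

theorem nonempty_oneDimLabel_equiv :
    Nonempty (OneDimLabel S x u ≃ IrreducibleClass (S.terwilliger x) 1) := by
  obtain ⟨e⟩ := exists_equiv_irreducibleClass (x := x) hS hu 1
  refine ⟨(Equiv.ofBijective (fun p => ⟨some (Sum.inl p), rfl⟩) ⟨?_, ?_⟩).trans e⟩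
  · intro p p' h
    exact Sum.inl_injective (Option.some_injective _ (congrArg Subtype.val h))
  · rintro ⟨_ | p | θ, h⟩
    · simp [irreducibleDim] at h
    · exact ⟨p, rfl⟩
    · simp [irreducibleDim] at h

theorem nonempty_twoDimLabel_equiv :
    Nonempty (TwoDimLabel S x u ≃ IrreducibleClass (S.terwilliger x) 2) := by
  obtain ⟨e⟩ := exists_equiv_irreducibleClass (x := x) hS hu 2
  refine ⟨(Equiv.ofBijective (fun θ => ⟨some (Sum.inr θ), rfl⟩) ⟨?_, ?_⟩).trans e⟩
  · intro p p' h
    exact Sum.inr_injective (Option.some_injective _ (congrArg Subtype.val h))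
  · rintro ⟨_ | p | θ, h⟩
    · simp [irreducibleDim] at h
    · simp [irreducibleDim] at h
    · exact ⟨θ, rfl⟩

theorem finrank_terwilliger [Fintype (OneDimLabel S x u)] [Fintype (TwoDimLabel S x u)] :
    Module.finrank ℂ (S.terwilliger x) =
      9 + Fintype.card (OneDimLabel S x u) + 4 * Fintype.card (TwoDimLabel S x u) := by
  have : ∀ i, IsSimpleModule (S.terwilliger x) (irreducible S x u i) :=
    isSimpleModule_irreducible hS hu
  have hfd : ∀ i, FiniteDimensional ℂ (irreducible S x u i) := fun i =>
    inferInstanceAs (FiniteDimensional ℂ ((irreducible S x u i).restrictScalars ℂ))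
  have hss := isSemisimpleModule_standard (x := x) hS
  rw [finrank_eq_sum_sq_of_simple_family (K := ℂ) (T := S.terwilliger x)
    (fun i => irreducible S x u i)]
  · have hd : ∀ i, Module.finrank ℂ (irreducible S x u i) = irreducibleDim i := fun i =>
      (moduleDim_submodule _).symm.trans (moduleDim_irreducible hS hu i)
    simp only [hd, Fintype.sum_option, Fintype.sum_sum_type, irreducibleDim, Finset.sum_const,
      Finset.card_univ, smul_eq_mul]
    ring
  · exact fun i i' hne => ⟨fun e => hne (irreducible_label_eq hS hu e)⟩
  · intro t ht
    -- Joint faithfulness: the standard module is a sum of simple submodules, each isomorphic to a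
    -- representative, and `t` kills every representative.
    have hker : ∀ z : X → ℂ, t • z = 0 := by
      intro z
      have hz : z ∈ sSup {m : Submodule (S.terwilliger x) (X → ℂ) |
          IsSimpleModule (S.terwilliger x) m} := by
        rw [IsSemisimpleModule.sSup_simples_eq_top]
        trivial
      rw [sSup_eq_iSup] at hz
      induction hz using Submodule.iSup_induction' with
      | mem m z hz =>
        by_cases hm : m ∈ {m : Submodule (S.terwilliger x) (X → ℂ) |
          IsSimpleModule (S.terwilliger x) m}
        · simp only [hm, iSup_pos] at hz
          have : IsSimpleModule (S.terwilliger x) m := hm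
          obtain ⟨i, ⟨e⟩⟩ := exists_linearEquiv_irreducible (x := x) hS hu m
          exact smul_eq_zero_of_linearEquiv e (ht i) hz
        · simp only [hm, iSup_neg, not_false_eq_true, Submodule.mem_bot] at hz
          rw [hz, smul_zero]
      | zero => exact smul_zero _
      | add a b _ _ ha hb => rw [smul_add, ha, hb, add_zero]
    ext y z
    have := congrFun (hker (Pi.single z 1)) y
    change t.1.mulVec (Pi.single z 1) y = 0 at this
    simpa using this

end BlockModule

/-! ### Counting the isomorphism classes -/

section Counting

theorem finite_blockEigenvalues (S : AssociationScheme X 2) (x : X) (j : Fin 3) :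
    {θ | blockEigenspace S x j θ ≠ ⊥}.Finite := by
  refine (Module.End.finite_hasEigenvalue
    (S.dualIdempotent x j * S.adj j).mulVecLin).subset fun θ hθ h => hθ ?_
  exact eq_bot_iff.mpr (blockEigenspace_le_eigenspace.trans h.le)

instance : Finite (TwoDimLabel S x u) :=
  ((finite_blockEigenvalues S x 1).subset fun _ h => h.2).to_subtype

variable (hu : Fintype.card X = 4 * u + 3) {α : ℂ}
    (hα : α = (-1 + (Real.sqrt (Fintype.card X) : ℂ) * Complex.I) / 2)

include hu hα

omit [DecidableEq X] in
theorem ne_star_self : α ≠ star α := by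
  intro h
  have h1 := im_pos_of_eq hu hα
  have h2 := congrArg Complex.im h
  simp only [Complex.star_def, Complex.conj_im] at h2
  linarith

omit [DecidableEq X] in
theorem ne_natCast : α ≠ u := by
  intro h
  have h1 := im_pos_of_eq hu hα
  rw [h, Complex.natCast_im] at h1
  exact lt_irrefl _ h1

theorem hasEigenvalue_subconstituent_iff (hS : S.IsAsymmetric) :
    Module.End.HasEigenvalue (Matrix.toLin' (S.subconstituent x 1)) α ↔
      blockEigenspace S x 1 α ≠ ⊥ := by
  rw [blockEigenspace_eq_map hS hu (by decide) (ne_natCast hu hα), Ne,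
    (Submodule.map_injective_of_injective extendZero_injective).eq_iff' (Submodule.map_bot _)]
  rfl

/-- Changing sides by `exists_root_neg` may change the root; conjugation then supplies the other
one. -/
theorem blockEigenspace_ne_bot_of_root (hS : S.IsAsymmetric) {j j' : Fin 3} (hj : j ≠ 0) (hj' : j' ≠ 0) {θ θ' : ℂ}
    (hθ : θ ^ 2 + θ + (u + 1) = 0) (hθ' : θ' ^ 2 + θ' + (u + 1) = 0)
    (h : blockEigenspace S x j θ ≠ ⊥) : blockEigenspace S x j' θ' ≠ ⊥ := by
  have same : ∀ {k : Fin 3} {η : ℂ}, η ^ 2 + η + (u + 1) = 0 → blockEigenspace S x k η ≠ ⊥ →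
      blockEigenspace S x k θ' ≠ ⊥ := by
    intro k η hη hk
    rcases (root_iff hu hα η).mp hη with rfl | rfl <;>
      rcases (root_iff hu hα θ').mp hθ' with rfl | rfl
    · exact hk
    · exact blockEigenspace_star_ne_bot hk
    · simpa using blockEigenspace_star_ne_bot hk
    · exact hk
  rcases fin_cases_neg j j' hj with rfl | rfl | rfl
  · exact absurd rfl hj'
  · exact same hθ h
  · obtain ⟨η, hη, hk⟩ := exists_root_neg hS hu hj hθ h
    exact same hη hk

theorem isEmpty_oneDimLabel (hS : S.IsAsymmetric) (h : blockEigenspace S x 1 α = ⊥) : IsEmpty (OneDimLabel S x u) :=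
  ⟨fun p => blockEigenspace_ne_bot_of_root hu hα hS p.2.1 (by decide : (1 : Fin 3) ≠ 0) p.2.2.1
    ((root_iff hu hα α).mpr (Or.inl rfl)) p.2.2.2 h⟩

theorem natCard_oneDimLabel (hS : S.IsAsymmetric) (h : blockEigenspace S x 1 α ≠ ⊥) :
    Finite (OneDimLabel S x u) ∧ Nat.card (OneDimLabel S x u) = 4 := by
  have hset : {p : Fin 3 × ℂ | p.1 ≠ 0 ∧ p.2 ^ 2 + p.2 + (u + 1) = 0 ∧
      blockEigenspace S x p.1 p.2 ≠ ⊥} =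
      ((({1, 2} : Finset (Fin 3)) ×ˢ ({α, star α} : Finset ℂ) : Finset (Fin 3 × ℂ)) :
        Set (Fin 3 × ℂ)) := by
    ext ⟨j, θ⟩
    simp only [Set.mem_ofPred_eq, Finset.coe_product, Set.mem_prod, Finset.mem_coe,
      Finset.mem_insert, Finset.mem_singleton]
    rw [root_iff hu hα θ]
    have hj : j ≠ 0 ↔ j = 1 ∨ j = 2 := by revert j; decide
    rw [hj]
    refine ⟨fun h => ⟨h.1, h.2.1⟩, fun h' => ⟨h'.1, h'.2, ?_⟩⟩
    exact blockEigenspace_ne_bot_of_root hu hα hS (by decide : (1 : Fin 3) ≠ 0) (hj.mpr h'.1)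
      ((root_iff hu hα α).mpr (Or.inl rfl)) ((root_iff hu hα θ).mpr h'.2) h
  have hcard : (({1, 2} : Finset (Fin 3)) ×ˢ ({α, star α} : Finset ℂ)).card = 4 := by
    rw [Finset.card_product, Finset.card_pair (by decide), Finset.card_pair (ne_star_self hu hα)]
  constructor
  · have hfin : {p : Fin 3 × ℂ | p.1 ≠ 0 ∧ p.2 ^ 2 + p.2 + (u + 1) = 0 ∧
        blockEigenspace S x p.1 p.2 ≠ ⊥}.Finite := by
      rw [hset]
      exact Finset.finite_toSet _
    exact hfin.to_subtype
  · change Nat.card {p : Fin 3 × ℂ | p.1 ≠ 0 ∧ p.2 ^ 2 + p.2 + (u + 1) = 0 ∧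
      blockEigenspace S x p.1 p.2 ≠ ⊥} = 4
    rw [hset, Nat.card_coe_set_eq, Set.ncard_coe_finset, hcard]

/-- Independent block eigenspaces share the `2u`-dimensional space `W` of sum-zero functions. Each
two-dimensional label takes at least one dimension; `α` and its conjugate take the same dimension
each. -/
theorem natCard_twoDimLabel_add_le (hS : S.IsAsymmetric) :
    Nat.card (TwoDimLabel S x u) +
      2 * Module.finrank ℂ (Module.End.eigenspace (Matrix.toLin' (S.subconstituent x 1)) α) ≤
      2 * u := by
  classical
  have := Fintype.ofFinite (TwoDimLabel S x u)
  let φ : ({y // S.rel x y = 1} → ℂ) →ₗ[ℂ] ℂ := Fintype.linearCombination ℂ fun _ => 1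
  have hφ : ∀ f, φ f = ∑ y, f y := fun f => by simp [φ, Fintype.linearCombination_apply]
  let W : Submodule ℂ (X → ℂ) := (LinearMap.ker φ).map (extendZero S x 1)
  have hW : Module.finrank ℂ W = 2 * u := by
    have h1 : Module.finrank ℂ (LinearMap.ker φ) = Module.finrank ℂ W :=
      (Submodule.equivMapOfInjective _ extendZero_injective _).finrank_eq
    have h2 := LinearMap.finrank_range_add_finrank_ker φ
    have h3 : LinearMap.range φ = ⊤ := by
      obtain ⟨y, hy⟩ := exists_rel_eq hS hu x 1
      rw [LinearMap.range_eq_top]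
      intro c
      exact ⟨Pi.single ⟨y, hy⟩ c, by simp [hφ]⟩
    have hc : Fintype.card {y // S.rel x y = 1} = 2 * u + 1 :=
      card_subconstituent hS hu x (by decide)
    rw [h3, finrank_top, Module.finrank_self, Module.finrank_fintype_fun_eq_card, h1, hc] at h2
    linarith
  have hle : ∀ θ, blockEigenspace S x 1 θ ≤ W := by
    intro θ z hz
    have hzr : extendZero S x 1 (fun y => z y) = z := by rw [extendZero_restrict, hz.2.1]
    refine ⟨fun y => z y, ?_, hzr⟩
    have := hz.1
    rw [← hzr, sum_extendZero] at this
    rw [SetLike.mem_coe, LinearMap.mem_ker, hφ, this]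
  -- `Bool` indexes the two roots, which no two-dimensional label can equal.
  let ev : TwoDimLabel S x u ⊕ Bool → ℂ := Sum.elim (fun θ => θ.1) (bif · then α else star α)
  have hroot : ∀ b : Bool, (bif b then α else star α) ^ 2 + (bif b then α else star α) +
      (u + 1 : ℂ) = 0 := by
    intro b
    rw [root_iff hu hα]
    cases b <;> simp
  have hev : Function.Injective ev := by
    rintro (θ | b) (θ' | b') h
    · exact congrArg _ (Subtype.ext h)
    · have h' : θ.1 = bif b' then α else star α := h
      exact absurd (by rw [h', hroot]) θ.2.1
    · have h' : (bif b then α else star α) = θ'.1 := h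
      exact absurd (by rw [← h', hroot]) θ'.2.1
    · have hne := ne_star_self hu hα
      cases b <;> cases b'
      · rfl
      · exact absurd h.symm hne
      · exact absurd h hne
      · rfl
  have hind : iSupIndep fun i => blockEigenspace S x 1 (ev i) :=
    ((Module.End.eigenspaces_iSupIndep
      (S.dualIdempotent x 1 * S.adj 1).mulVecLin).comp hev).mono
      fun i => blockEigenspace_le_eigenspace
  have key := sum_finrank_le_of_iSupIndep hind (fun i => hle (ev i))
  rw [Fintype.sum_sum_type, hW] at key
  have hα' : Module.finrank ℂ (blockEigenspace S x 1 α) =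
      Module.finrank ℂ (Module.End.eigenspace (Matrix.toLin' (S.subconstituent x 1)) α) :=
    finrank_blockEigenspace hS hu (by decide) (ne_natCast hu hα)
  have h2 : ∑ b : Bool, Module.finrank ℂ (blockEigenspace S x 1 (ev (Sum.inr b))) =
      2 * Module.finrank ℂ (Module.End.eigenspace (Matrix.toLin' (S.subconstituent x 1)) α) := by
    rw [Fintype.sum_bool]
    change Module.finrank ℂ (blockEigenspace S x 1 α) +
      Module.finrank ℂ (blockEigenspace S x 1 (star α)) = _
    rw [finrank_blockEigenspace_star, hα']
    ring
  have h1 : Fintype.card (TwoDimLabel S x u) ≤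
      ∑ θ : TwoDimLabel S x u, Module.finrank ℂ (blockEigenspace S x 1 (ev (Sum.inl θ))) := by
    rw [Fintype.card_eq_sum_ones]
    exact Finset.sum_le_sum fun θ _ => Submodule.one_le_finrank_iff.mpr θ.2.2
  rw [Nat.card_eq_fintype_card]
  omega

end Counting

end AssociationScheme

/-! ### The indicator `ε` and the final assembly -/

theorem oneDimIndicator_eq_one {T : Type w} [Ring T] [Algebra ℂ T]
    (h : Nonempty (IrreducibleClass T 1)) : oneDimIndicator T = 1 := by
  obtain ⟨q⟩ := h
  induction q using Quotient.inductionOn with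
  | h V => exact if_pos ⟨V.1, V.2⟩

theorem oneDimIndicator_eq_zero {T : Type w} [Ring T] [Algebra ℂ T]
    (h : IsEmpty (IrreducibleClass T 1)) : oneDimIndicator T = 0 :=
  if_neg fun ⟨V, hV⟩ => h.false (Quotient.mk _ ⟨V, hV⟩)

open AssociationScheme in
theorem theorem4p3 {X : Type w} [Fintype X] [DecidableEq X] (S : AssociationScheme X 2)
    (hS : S.IsAsymmetric) (u : ℕ) (hu : Fintype.card X = 4 * u + 3) (x : X) :
    let T := S.terwilliger x
    let B := Matrix.toLin' (S.subconstituent x 1)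
    let α : ℂ := (-1 + (Real.sqrt (Fintype.card X) : ℂ) * Complex.I) / 2
    let dα : ℕ := Module.finrank ℂ (Module.End.eigenspace B α)
    let m₂ : ℕ := Nat.card (IrreducibleClass T 2)
    let ε : ℕ := oneDimIndicator T
    (∀ (V : Type v) [AddCommGroup V] [Module T V], IsSimpleModule T V →
        ¬ Nonempty (V ≃ₗ[T] S.primaryModule x) → moduleDim T V = 1 ∨ moduleDim T V = 2) ∧
      (Finite (IrreducibleClass T 1) ∧
        (Nat.card (IrreducibleClass T 1) = 0 ∨ Nat.card (IrreducibleClass T 1) = 4) ∧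
        (Nat.card (IrreducibleClass T 1) = 4 ↔ Module.End.HasEigenvalue B α)) ∧
      (Finite (IrreducibleClass T 2) ∧
        (m₂ : ℤ) ≤ 2 * ((u : ℤ) - (dα : ℤ)) ∧
        Module.finrank ℂ T = 9 + 4 * ε + 4 * m₂) := by
  intro T B α dα m₂ ε
  obtain ⟨e₁⟩ := nonempty_oneDimLabel_equiv (x := x) hS hu
  obtain ⟨e₂⟩ := nonempty_twoDimLabel_equiv (x := x) hS hu
  have hα : α = (-1 + (Real.sqrt (Fintype.card X) : ℂ) * Complex.I) / 2 := rfl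
  have hB : Module.End.HasEigenvalue B α ↔ blockEigenspace S x 1 α ≠ ⊥ :=
    hasEigenvalue_subconstituent_iff hu hα hS
  -- One dichotomy settles both the 0-or-4 count and `ε`, so the one-dimensional modules contribute
  -- `4 * ε` to the dimension.
  have hone : Finite (IrreducibleClass T 1) ∧
      (blockEigenspace S x 1 α ≠ ⊥ ∧ Nat.card (IrreducibleClass T 1) = 4 ∧ ε = 1 ∨
        blockEigenspace S x 1 α = ⊥ ∧ Nat.card (IrreducibleClass T 1) = 0 ∧ ε = 0) := by
    by_cases h : blockEigenspace S x 1 α = ⊥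
    · have := isEmpty_oneDimLabel hu hα hS h
      have : IsEmpty (IrreducibleClass T 1) := e₁.symm.isEmpty
      exact ⟨inferInstance, Or.inr ⟨h, Nat.card_of_isEmpty, oneDimIndicator_eq_zero this⟩⟩
    · obtain ⟨hf, hc⟩ := natCard_oneDimLabel hu hα hS h
      rw [Nat.card_congr e₁] at hc
      have hpos : 0 < Nat.card (IrreducibleClass T 1) := hc.symm ▸ Nat.succ_pos 3
      have hn : Nonempty (IrreducibleClass T 1) := (Nat.card_pos_iff.mp hpos).1
      exact ⟨Finite.of_equiv _ e₁, Or.inl ⟨h, hc, oneDimIndicator_eq_one hn⟩⟩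
  have hm₂ : m₂ = Nat.card (TwoDimLabel S x u) := (Nat.card_congr e₂).symm
  refine ⟨?_, ⟨hone.1, ?_, ?_⟩, Finite.of_equiv _ e₂, ?_, ?_⟩
  · intro V _ _ hV hP
    obtain ⟨i, ⟨e⟩⟩ := exists_linearEquiv_irreducible (x := x) hS hu V
    rw [moduleDim_congr (W := irreducible S x u i) e, moduleDim_irreducible hS hu]
    rcases i with _ | p | θ
    · exact absurd ⟨e⟩ hP
    · exact Or.inl rfl
    · exact Or.inr rfl
  · rcases hone.2 with h | h
    · exact Or.inr h.2.1
    · exact Or.inl h.2.1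
  · rw [hB]
    rcases hone.2 with h | h
    · simp [h.1, h.2.1]
    · simp [h.1, h.2.1]
  · have := natCard_twoDimLabel_add_le (x := x) hu hα hS
    rw [← hm₂] at this
    have h : (m₂ : ℤ) + 2 * dα ≤ 2 * u := by exact_mod_cast this
    linarith
  · have : Finite (IrreducibleClass T 1) := hone.1
    have : Finite (OneDimLabel S x u) := Finite.of_equiv _ e₁.symm
    have := Fintype.ofFinite (OneDimLabel S x u)
    have := Fintype.ofFinite (TwoDimLabel S x u)
    have h1 : Fintype.card (OneDimLabel S x u) = 4 * ε := by
      rw [← Nat.card_eq_fintype_card, Nat.card_congr e₁]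
      rcases hone.2 with h | h
      · rw [h.2.1, h.2.2]
      · rw [h.2.1, h.2.2]
    rw [finrank_terwilliger hS hu, h1, hm₂, Nat.card_eq_fintype_card]
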